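/- Let $K$ be an algebraically closed field of characteristic $p$, where $p$ is a prime with $p \neq 2, 3$, and let $E : y^2 = x^3 + Ax + B$ be an ordinary elliptic curve over $K$. Let $K[\varepsilon] = K[X]/(X^2)$ be the ring of dual numbers, and let $\tilde E = \tilde E(K[\varepsilon])$ be the group of points over $K[\varepsilon]$ of the curve with the same equation, that is, of the affine points $(x : y : 1)$ with $x, y \in K[\varepsilon]$ and $y^2 = x^3 + Ax + B$, and of the points at infinity $\mathcal O_k = (k\varepsilon : 1 : 0)$, $k \in K$, under the chord and tangent addition law. Let $\mathcal O = \mathcal O_0$ be the neutral element, and let $\Theta = \{\mathcal O_k : k \in K\}$. Fix a point $R \in E[p]$ with $R \notin E[2]$, a point $T \in E(K)$ of order two, and an addition chain decomposition $C$ of $p$: for some set $S \subseteq \{1, \dots, p\}$ with $p \in S$ in which every $k > 1$ is a sum of two elements of $S$, a sequence of steps, each replacing a summand $i + j$ by the two summands $i, j$ with $i, j, i + j \in S$, that turns $p$ into a sum of $p$ ones. For $P \in E[p]$ with $P \neq \mathcal O$ let $\ell_{i,j}$ be the (normalized) equation of the line through $iP$ and $jP$ (the tangent if $iP = jP$), $v_i$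 that of the vertical line through $iP$, and $\tau$ the translation by $-T$; put $h_{i,j} = (\ell_{i,j}/v_{i+j}) \circ \tau$ if $i + j \neq p$ and $h_{i,j} = v_i \circ \tau$ if $i + j = p$. Define $$e(P, \mathcal O_k) = \prod_{(i + j \mapsto i, j) \in C} \frac{h_{i,j}(\mathcal O_k + R)}{h_{i,j}(R)} \quad \text{if } P \neq \mathcal O \text{ and } k \neq 0, \qquad e(P, \mathcal O_k) = 1 \quad \text{otherwise.}$$ Then $\tilde E[p] = E[p] \oplus \Theta$, and there is exactly one map $e_p : \tilde E[p] \times \tilde E[p] \to \mu_p(K[\varepsilon])$ that is bilinear and antisymmetric ($e_p(P, Q) = e_p(Q, P)^{-1}$), is trivial on $E[p] \times E[p]$ and on $\Theta \times \Theta$, and equals $e$ on $E[p] \times \Theta$. This map $e_p$ is non-degenerate: if $e_p(P, Q) = 1$ for all $P \in \tilde E[p]$, then $Q = \mathcal O$, and if $e_p(P, Q) = 1$ for all $Q \in \tilde E[p]$, then $P = \mathcal O$. -/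

import Mathlib

open scoped DualNumber

namespace DualCurve

variable {K : Type*} [Field K]

/-- The canonical lift of `E` to the dual numbers: the same Weierstrass equation, read in `K[ε]`. -/
abbrev canonicalLift (E : WeierstrassCurve K) : WeierstrassCurve K[ε] :=
  E.map (TrivSqZeroExt.inlHom K K)

/-- The points over `K[ε]` of the canonical lift of `E`: the affine points `(x : y : 1)` with
`x, y ∈ K[ε]` satisfying the Weierstrass equation, and the points at infinity
`𝒪ₖ = (kε : 1 : 0)` with `k ∈ K`. -/
inductive DualPoint (E : WeierstrassCurve K)
  | affine (x y : K[ε]) (h : (canonicalLift E).toAffine.Equation x y)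
  | inf (k : K)

variable {E : WeierstrassCurve K}

theorem equation_iff [E.IsShortNF] (x y : K[ε]) :
    (canonicalLift E).toAffine.Equation x y ↔
      y ^ 2 = x ^ 3 + TrivSqZeroExt.inl E.a₄ * x + TrivSqZeroExt.inl E.a₆ := by
  rw [WeierstrassCurve.Affine.equation_iff]
  simp

/-- `kε`. -/
abbrev kEps (k : K) : K[ε] := TrivSqZeroExt.inr k

theorem kEps_mul_kEps (j k : K) : kEps j * kEps k = 0 :=
  TrivSqZeroExt.inr_mul_inr _ _ _

theorem dual_mul_inv {x : K[ε]} (hx : x.fst ≠ 0) : x * x⁻¹ = 1 :=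
  TrivSqZeroExt.mul_inv_cancel hx

/-- The value at `(x₁, x₂)` of `(f(x₁) - f(x₂)) / (x₁ - x₂)`, where `f = X³ + AX + B`. -/
def cubicQuot (E : WeierstrassCurve K) (x₁ x₂ : K[ε]) : K[ε] :=
  x₁ ^ 2 + x₁ * x₂ + x₂ ^ 2 + TrivSqZeroExt.inl E.a₄

theorem sub_mul_cubicQuot [E.IsShortNF] {x₁ y₁ x₂ y₂ : K[ε]}
    (h₁ : (canonicalLift E).toAffine.Equation x₁ y₁)
    (h₂ : (canonicalLift E).toAffine.Equation x₂ y₂) :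
    (x₁ - x₂) * cubicQuot E x₁ x₂ = (y₁ - y₂) * (y₁ + y₂) := by
  rw [equation_iff] at h₁ h₂
  rw [cubicQuot]
  linear_combination h₂ - h₁

/-- The slope of the line through two affine points whose sum is affine. As
`(y₁ - y₂)(y₁ + y₂) = (x₁ - x₂)(x₁² + x₁x₂ + x₂² + A)`, it is `(y₁ - y₂) / (x₁ - x₂)` or
`(x₁² + x₁x₂ + x₂² + A) / (y₁ + y₂)`, whichever denominator is invertible in `K[ε]`; at
`(x₁, y₁) = (x₂, y₂)` the latter is the slope `(3x₁² + A) / (2y₁)` of the tangent. -/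
noncomputable def dualSlope [DecidableEq K] (E : WeierstrassCurve K) (x₁ x₂ y₁ y₂ : K[ε]) : K[ε] :=
  if x₁.fst ≠ x₂.fst then (y₁ - y₂) * (x₁ - x₂)⁻¹ else cubicQuot E x₁ x₂ * (y₁ + y₂)⁻¹

/-- The third point of intersection of the line through two affine points of opposite reductions is
`(w : 1 : 0)`, where `w` is the inverse slope `(x₁ - x₂) / (y₁ - y₂)`, or equivalently
`(y₁ + y₂) / (x₁² + x₁x₂ + x₂² + A)`, whichever denominator is invertible. The sum of the two points
is then `(-w : 1 : 0)`. -/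
noncomputable def dualInvSlope [DecidableEq K] (E : WeierstrassCurve K) (x₁ x₂ y₁ y₂ : K[ε]) :
    K[ε] :=
  if y₁.fst ≠ y₂.fst then (x₁ - x₂) * (y₁ - y₂)⁻¹ else (y₁ + y₂) * (cubicQuot E x₁ x₂)⁻¹

theorem dualSlope_spec [DecidableEq K] [E.IsShortNF] {x₁ y₁ x₂ y₂ : K[ε]}
    (h₁ : (canonicalLift E).toAffine.Equation x₁ y₁)
    (h₂ : (canonicalLift E).toAffine.Equation x₂ y₂)
    (h : ¬ (x₁.fst = x₂.fst ∧ y₁.fst + y₂.fst = 0)) :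
    y₁ - y₂ = dualSlope E x₁ x₂ y₁ y₂ * (x₁ - x₂) ∧
      dualSlope E x₁ x₂ y₁ y₂ * (y₁ + y₂) = cubicQuot E x₁ x₂ := by
  have key := sub_mul_cubicQuot h₁ h₂
  by_cases hx : x₁.fst = x₂.fst
  · have hy : (y₁ + y₂).fst ≠ 0 := fun hy => h ⟨hx, by simpa using hy⟩
    have hi := dual_mul_inv hy
    rw [dualSlope, if_neg (not_not.2 hx)]
    constructor
    · linear_combination (y₁ - y₂) * (-hi) - (y₁ + y₂)⁻¹ * key
    · linear_combination cubicQuot E x₁ x₂ * hi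
  · have hd : (x₁ - x₂).fst ≠ 0 := by simpa [sub_eq_zero] using hx
    have hi := dual_mul_inv hd
    rw [dualSlope, if_pos hx]
    constructor
    · linear_combination (y₁ - y₂) * (-hi)
    · linear_combination cubicQuot E x₁ x₂ * hi - (x₁ - x₂)⁻¹ * key

theorem equation_add [DecidableEq K] [E.IsShortNF] {x₁ y₁ x₂ y₂ m : K[ε]}
    (h₁ : (canonicalLift E).toAffine.Equation x₁ y₁)
    (hm : y₁ - y₂ = m * (x₁ - x₂) ∧ m * (y₁ + y₂) = cubicQuot E x₁ x₂) :
    (canonicalLift E).toAffine.Equation (m ^ 2 - x₁ - x₂)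
      (m * (x₁ - (m ^ 2 - x₁ - x₂)) - y₁) := by
  obtain ⟨hm₁, hm₂⟩ := hm
  rw [equation_iff] at h₁ ⊢
  rw [cubicQuot] at hm₂
  linear_combination h₁ + (m ^ 2 - 2 * x₁ - x₂) * hm₂ + m * (m ^ 2 - 2 * x₁ - x₂) * hm₁

theorem equation_translate [E.IsShortNF] {x y : K[ε]}
    (h : (canonicalLift E).toAffine.Equation x y) (k : K) :
    (canonicalLift E).toAffine.Equation (x - 2 * y * kEps k)
      (y - (3 * x ^ 2 + TrivSqZeroExt.inl E.a₄) * kEps k) := by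
  have hk := kEps_mul_kEps k k
  rw [equation_iff] at h ⊢
  linear_combination h + ((3 * x ^ 2 + TrivSqZeroExt.inl E.a₄) ^ 2 - 12 * x * y ^ 2
    + 8 * y ^ 3 * kEps k) * hk

namespace DualPoint

/-- The chord and tangent addition law over `K[ε]`. The sum of an affine point and `𝒪ₖ` is the
affine point `(x - 2ykε : y - (3x² + A)kε : 1)`. -/
noncomputable def add [DecidableEq K] [E.IsShortNF] : DualPoint E → DualPoint E → DualPoint E
  | inf j, inf k => inf (j + k)
  | affine _ _ h, inf k => affine _ _ (equation_translate h k)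
  | inf k, affine _ _ h => affine _ _ (equation_translate h k)
  | affine x₁ y₁ h₁, affine x₂ y₂ h₂ =>
    if h : x₁.fst = x₂.fst ∧ y₁.fst + y₂.fst = 0 then
      inf (-(dualInvSlope E x₁ x₂ y₁ y₂).snd)
    else
      affine _ _ (equation_add h₁ (dualSlope_spec h₁ h₂ h))

/-- The inverse of `(x : y : 1)` is `(x : -y : 1)`, and the inverse of `(kε : 1 : 0)` is
`(-kε : 1 : 0)`. -/
def neg [E.IsShortNF] : DualPoint E → DualPoint E
  | inf k => inf (-k)
  | affine x y h => affine x (-y) ((equation_iff _ _).2 (by rw [neg_sq, (equation_iff _ _).1 h]))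

instance : Zero (DualPoint E) := ⟨inf 0⟩
noncomputable instance [DecidableEq K] [E.IsShortNF] : Add (DualPoint E) := ⟨add⟩
instance [E.IsShortNF] : Neg (DualPoint E) := ⟨neg⟩

/-- The inclusion of `E(K)` in `Ẽ(K[ε])`. -/
def ofBase : E.toAffine.Point → DualPoint E
  | .zero => inf 0
  | .some x y h => affine (TrivSqZeroExt.inl x) (TrivSqZeroExt.inl y)
      (h.1.map (TrivSqZeroExt.inlHom K K))


theorem fst_two : (2 : K[ε]).fst = 2 := rfl
theorem fst_three : (3 : K[ε]).fst = 3 := rfl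
theorem snd_two : (2 : K[ε]).snd = 0 := by
  rw [← one_add_one_eq_two, TrivSqZeroExt.snd_add, TrivSqZeroExt.snd_one, add_zero]
theorem snd_three : (3 : K[ε]).snd = 0 := by
  rw [← two_add_one_eq_three, TrivSqZeroExt.snd_add, TrivSqZeroExt.snd_one, snd_two, add_zero]

theorem affine_congr {x y x' y' : K[ε]} {h : (canonicalLift E).toAffine.Equation x y}
    {h' : (canonicalLift E).toAffine.Equation x' y'} (hx : x = x') (hy : y = y') :
    affine (E := E) x y h = affine x' y' h' := by
  subst hx hy; rfl

theorem two_ne_zero_of_isElliptic (E : WeierstrassCurve K) [E.IsShortNF] [E.IsElliptic] :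
    (2 : K) ≠ 0 := by
  intro h
  apply E.isUnit_Δ.ne_zero
  rw [E.Δ_of_isShortNF]
  linear_combination (-8 * (4 * E.a₄ ^ 3 + 27 * E.a₆ ^ 2)) * h

theorem deriv_ne_zero [E.IsShortNF] {x : K}
    (h : E.toAffine.Nonsingular x 0) : 3 * x ^ 2 + E.a₄ ≠ 0 := by
  rw [WeierstrassCurve.Affine.nonsingular_iff] at h
  simp at h
  intro h0
  apply h.2
  linear_combination -h0

theorem negY_eq [E.IsShortNF] (x y : K) : E.toAffine.negY x y = -y := by
  simp [WeierstrassCurve.Affine.negY]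

section

variable [DecidableEq K] [E.IsShortNF]

/-- The point `P + 𝒪ₖ`, for `P ∈ E(K)`. -/
noncomputable def translate (P : E.toAffine.Point) (k : K) : DualPoint E := ofBase P + inf k

theorem inf_add_inf (j k : K) : (inf j + inf k : DualPoint E) = inf (j + k) := rfl

theorem translate_zero (k : K) : translate (E := E) 0 k = inf k := by
  change inf (0 + k) = inf k
  rw [zero_add]

theorem affine_add_affine_of_eq {x₁ y₁ x₂ y₂ : K[ε]}
    (h₁ : (canonicalLift E).toAffine.Equation x₁ y₁)
    (h₂ : (canonicalLift E).toAffine.Equation x₂ y₂)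
    (h : x₁.fst = x₂.fst ∧ y₁.fst + y₂.fst = 0) :
    affine (E := E) x₁ y₁ h₁ + affine x₂ y₂ h₂ = inf (-(dualInvSlope E x₁ x₂ y₁ y₂).snd) :=
  dif_pos h

theorem affine_add_affine_of_ne {x₁ y₁ x₂ y₂ : K[ε]}
    (h₁ : (canonicalLift E).toAffine.Equation x₁ y₁)
    (h₂ : (canonicalLift E).toAffine.Equation x₂ y₂)
    (h : ¬ (x₁.fst = x₂.fst ∧ y₁.fst + y₂.fst = 0)) :
    ∃ (m : K[ε]) (h₃ : (canonicalLift E).toAffine.Equation (m ^ 2 - x₁ - x₂)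
      (m * (x₁ - (m ^ 2 - x₁ - x₂)) - y₁)), y₁ - y₂ = m * (x₁ - x₂) ∧
      m * (y₁ + y₂) = cubicQuot E x₁ x₂ ∧
      affine (E := E) x₁ y₁ h₁ + affine x₂ y₂ h₂ = affine _ _ h₃ :=
  ⟨_, equation_add h₁ (dualSlope_spec h₁ h₂ h), (dualSlope_spec h₁ h₂ h).1,
    (dualSlope_spec h₁ h₂ h).2, dif_neg h⟩

theorem translate_add_translate [E.IsElliptic] (P Q : E.toAffine.Point) (j k : K) :
    translate P j + translate Q k = translate (P + Q) (j + k) := by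
  have h2 := two_ne_zero_of_isElliptic E
  rcases P with _ | ⟨x₁, y₁, h₁⟩
  · change translate 0 j + _ = translate (0 + Q) _
    rw [translate_zero, zero_add]
    rcases Q with _ | ⟨x₂, y₂, h₂⟩
    · change _ + translate 0 k = translate 0 _
      rw [translate_zero, translate_zero]; rfl
    · apply affine_congr <;> ext <;> simp <;> ring
  rcases Q with _ | ⟨x₂, y₂, h₂⟩
  · change _ + translate 0 k = translate (_ + 0) _
    rw [translate_zero, add_zero]
    apply affine_congr <;> ext <;> simp <;> ring
  by_cases h : x₁ = x₂ ∧ y₁ = E.toAffine.negY x₂ y₂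
  · rw [WeierstrassCurve.Affine.Point.add_of_Y_eq h.1 h.2, translate_zero]
    obtain ⟨rfl, h⟩ := h
    rw [negY_eq] at h
    obtain rfl : y₂ = -y₁ := by rw [h, neg_neg]
    refine (affine_add_affine_of_eq _ _ (by simp)).trans (congrArg inf ?_)
    rw [dualInvSlope]
    by_cases hy : y₁ = 0
    · subst hy
      have hd := deriv_ne_zero h₁
      rw [if_neg (by simp), cubicQuot]
      have hd' : x₁ ^ 2 + x₁ * x₁ + x₁ ^ 2 + E.a₄ ≠ 0 := by convert hd using 1; ring
      have hd₂ := inv_mul_cancel₀ hd'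
      simp [fst_three]
      linear_combination (j + k) * hd₂
    · have hyy : y₁ ≠ -y₁ := fun e => mul_ne_zero h2 hy (by linear_combination e)
      rw [if_pos (by simpa using hyy)]
      have hd : y₁ + y₁ ≠ 0 := fun e => hyy (by linear_combination e)
      have hd₂ := inv_mul_cancel₀ hd
      simp [fst_two]
      linear_combination (j + k) * hd₂
  · rw [WeierstrassCurve.Affine.Point.add_some h]
    have hne : ¬ (x₁ = x₂ ∧ y₁ + y₂ = 0) := fun e =>
      h ⟨e.1, by rw [negY_eq]; linear_combination e.2⟩
    have e₁ := WeierstrassCurve.Affine.equation_iff .. |>.1 h₁.1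
    have e₂ := WeierstrassCurve.Affine.equation_iff .. |>.1 h₂.1
    simp at e₁ e₂
    set X₁ : K[ε] := TrivSqZeroExt.inl x₁ - 2 * TrivSqZeroExt.inl y₁ * kEps j with hX₁
    set Y₁ : K[ε] := TrivSqZeroExt.inl y₁ -
      (3 * TrivSqZeroExt.inl x₁ ^ 2 + TrivSqZeroExt.inl E.a₄) * kEps j with hY₁
    set X₂ : K[ε] := TrivSqZeroExt.inl x₂ - 2 * TrivSqZeroExt.inl y₂ * kEps k with hX₂
    set Y₂ : K[ε] := TrivSqZeroExt.inl y₂ -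
      (3 * TrivSqZeroExt.inl x₂ ^ 2 + TrivSqZeroExt.inl E.a₄) * kEps k with hY₂
    have H₁ : (canonicalLift E).toAffine.Equation X₁ Y₁ :=
      equation_translate (h₁.1.map (TrivSqZeroExt.inlHom K K)) j
    have H₂ : (canonicalLift E).toAffine.Equation X₂ Y₂ :=
      equation_translate (h₂.1.map (TrivSqZeroExt.inlHom K K)) k
    have hXY : ¬ (X₁.fst = X₂.fst ∧ Y₁.fst + Y₂.fst = 0) := by
      simpa [hX₁, hX₂, hY₁, hY₂] using hne
    obtain ⟨M, h₃, s₁, s₂, hadd⟩ := affine_add_affine_of_ne H₁ H₂ hXY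
    refine hadd.trans ?_
    clear hadd
    have a₁ := congrArg TrivSqZeroExt.fst s₁
    have a₂ := congrArg TrivSqZeroExt.snd s₁
    have b₁ := congrArg TrivSqZeroExt.fst s₂
    have b₂ := congrArg TrivSqZeroExt.snd s₂
    simp [hX₁, hX₂, hY₁, hY₂, cubicQuot, fst_two, fst_three] at a₁ a₂ b₁ b₂
    set m := M.fst with hm
    set n := M.snd with hn
    have hslope : E.toAffine.slope x₁ x₂ y₁ y₂ = m := by
      by_cases hx : x₁ = x₂
      · subst hx
        have hy : y₁ + y₂ ≠ 0 := fun e => hne ⟨rfl, e⟩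
        have hy' : y₁ = y₂ := by linear_combination a₁
        subst hy'
        rw [WeierstrassCurve.Affine.slope_of_Y_ne rfl (by
          rw [negY_eq]; exact fun e => hy (by linear_combination e)), negY_eq, div_eq_iff (by
          simpa using hy)]
        simp
        linear_combination -b₁
      · rw [WeierstrassCurve.Affine.slope_of_X_ne hx, div_eq_iff (sub_ne_zero.2 hx)]
        exact a₁
    have hn' : n = (m ^ 2 - 2 * x₁ - x₂) * j + (m ^ 2 - x₁ - 2 * x₂) * k := by
      by_cases hx : x₁ = x₂
      · subst hx
        have hy : y₁ + y₂ ≠ 0 := fun e => hne ⟨rfl, e⟩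
        have hy' : y₁ = y₂ := by linear_combination a₁
        subst hy'
        apply mul_right_cancel₀ hy
        linear_combination b₂ - (m * (j + k)) * b₁
      · apply mul_right_cancel₀ (sub_ne_zero.2 hx)
        linear_combination -a₂ + (j - k) * b₁ + m * (j + k) * a₁
    apply affine_congr
    · ext
      · simp [hX₁, hX₂, hslope, ← hm, WeierstrassCurve.Affine.addX]
      · simp [hX₁, hX₂, hslope, ← hm, ← hn, WeierstrassCurve.Affine.addX,
          WeierstrassCurve.Affine.addY, fst_two, WeierstrassCurve.Affine.negAddY]
        linear_combination 2 * m * hn' - 2 * k * a₁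
    · ext
      · simp [hX₁, hX₂, hY₁, hslope, ← hm, WeierstrassCurve.Affine.addX,
          WeierstrassCurve.Affine.addY, WeierstrassCurve.Affine.negAddY]
        ring
      · simp [hX₁, hX₂, hY₁, hslope, ← hm, ← hn, WeierstrassCurve.Affine.addX,
          fst_two, fst_three]
        linear_combination (x₁ - (m ^ 2 - x₁ - x₂) - 2 * m ^ 2) * hn' - (2 * j + k) * b₁
          + (k - 2 * j) * m * a₁

theorem translate_surjective [E.IsElliptic] (P : DualPoint E) : ∃ Q k, P = translate Q k := by
  have h2 := two_ne_zero_of_isElliptic E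
  rcases P with ⟨x, y, h⟩ | k
  · have h' := (equation_iff x y).1 h
    have a₀ := congrArg TrivSqZeroExt.fst h'
    have a₁ := congrArg TrivSqZeroExt.snd h'
    simp [pow_succ] at a₀ a₁
    have hE : E.toAffine.Equation x.fst y.fst := by
      rw [WeierstrassCurve.Affine.equation_iff]
      simp
      linear_combination a₀
    have hN := WeierstrassCurve.Affine.equation_iff_nonsingular.1 hE
    by_cases hy : y.fst = 0
    · have hd : 3 * x.fst ^ 2 + E.a₄ ≠ 0 := deriv_ne_zero (by rw [← hy]; exact hN)
      refine ⟨.some _ _ hN, -y.snd / (3 * x.fst ^ 2 + E.a₄), affine_congr ?_ ?_⟩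
      · ext
        · simp
        · simp [hy]
          apply mul_left_cancel₀ hd
          rw [hy] at a₁
          linear_combination -a₁
      · ext
        · simp
        · simp [fst_three]
          field_simp
    · refine ⟨.some _ _ hN, -x.snd / (2 * y.fst), affine_congr ?_ ?_⟩
      · ext
        · simp
        · simp [fst_two]
          field_simp
      · ext
        · simp
        · simp [fst_three]
          field_simp
          linear_combination a₁
  · exact ⟨0, k, (translate_zero k).symm⟩

theorem translate_zero_right (P : E.toAffine.Point) : translate P 0 = ofBase P := by
  rcases P with _ | ⟨x, y, h⟩
  · exact translate_zero 0
  · apply affine_congr <;> ext <;> simp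

theorem neg_translate (P : E.toAffine.Point) (k : K) : -translate P k = translate (-P) (-k) := by
  rcases P with _ | ⟨x, y, h⟩
  · change -translate 0 k = translate (-0) (-k)
    rw [translate_zero, neg_zero, translate_zero]; rfl
  · rw [WeierstrassCurve.Affine.Point.neg_some]
    apply affine_congr <;> ext <;> simp

noncomputable instance [E.IsElliptic] : AddCommGroup (DualPoint E) where
  add_assoc P Q R := by
    obtain ⟨P, i, rfl⟩ := translate_surjective P
    obtain ⟨Q, j, rfl⟩ := translate_surjective Q
    obtain ⟨R, k, rfl⟩ := translate_surjective R
    simp only [translate_add_translate, add_assoc]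
  zero_add P := by
    obtain ⟨P, i, rfl⟩ := translate_surjective P
    rw [show (0 : DualPoint E) = translate 0 0 from (translate_zero 0).symm,
      translate_add_translate, zero_add, zero_add]
  add_zero P := by
    obtain ⟨P, i, rfl⟩ := translate_surjective P
    rw [show (0 : DualPoint E) = translate 0 0 from (translate_zero 0).symm,
      translate_add_translate, add_zero, add_zero]
  neg_add_cancel P := by
    obtain ⟨P, i, rfl⟩ := translate_surjective P
    rw [neg_translate, translate_add_translate, neg_add_cancel, neg_add_cancel]
    exact translate_zero 0
  add_comm P Q := by
    obtain ⟨P, i, rfl⟩ := translate_surjective P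
    obtain ⟨Q, j, rfl⟩ := translate_surjective Q
    rw [translate_add_translate, translate_add_translate, add_comm P, add_comm i]
  nsmul := nsmulRec
  zsmul := zsmulRec

variable [E.IsElliptic]

/-- The inclusion of `E(K)` in `Ẽ(K[ε])` as a homomorphism. -/
noncomputable def ofBaseHom : E.toAffine.Point →+ DualPoint E where
  toFun := ofBase
  map_zero' := rfl
  map_add' P Q := by
    rw [← translate_zero_right, ← translate_zero_right, ← translate_zero_right,
      translate_add_translate, add_zero]

/-- `k ↦ 𝒪ₖ` as a homomorphism; its range is `Θ`. -/
noncomputable def infHom : K →+ DualPoint E where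
  toFun := inf
  map_zero' := rfl
  map_add' _ _ := rfl

end

end DualPoint

section Pairing

variable [DecidableEq K] [E.IsShortNF] [E.IsElliptic]

/-- `E(K)[p]`. -/
abbrev BaseTorsion (E : WeierstrassCurve K) (p : ℕ) : AddSubgroup E.toAffine.Point :=
  AddSubgroup.torsionBy E.toAffine.Point (p : ℤ)

/-- `Ẽ(K[ε])[p]`. -/
noncomputable abbrev DualTorsion (E : WeierstrassCurve K) [E.IsShortNF] [E.IsElliptic] (p : ℕ) :
    AddSubgroup (DualPoint E) :=
  AddSubgroup.torsionBy (DualPoint E) (p : ℤ)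

/-- The inclusion of `E[p]` in `Ẽ[p]`. -/
noncomputable def baseTorsion {p : ℕ} (P : BaseTorsion E p) : DualTorsion E p :=
  ⟨DualPoint.ofBaseHom P.1, AddSubgroup.torsionBy.nsmul_iff.2 (by
    rw [← map_nsmul, AddSubgroup.torsionBy.nsmul_iff.1 P.2, map_zero])⟩

/-- The point `𝒪ₖ ∈ Θ` as an element of `Ẽ[p]`. -/
noncomputable def thetaTorsion (E : WeierstrassCurve K) [E.IsShortNF] [E.IsElliptic] (p : ℕ)
    [CharP K p] (k : K) : DualTorsion E p :=
  ⟨DualPoint.infHom k, AddSubgroup.torsionBy.nsmul_iff.2 (by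
    rw [← map_nsmul, nsmul_eq_mul, CharP.cast_eq_zero, zero_mul, map_zero])⟩

/-- The left side, at `(X, Y) ∈ K[ε]²`, of the normalized affine equation of the line through two
points of `E(K)`: `Y - mX - b` if the line is not vertical and `X - c` if it is. (The line through
the point at infinity twice is `Z = 0`, with affine equation `1`.) -/
noncomputable def lineEval : E.toAffine.Point → E.toAffine.Point → K[ε] → K[ε] → K[ε]
  | .zero, .zero, _, _ => 1
  | .zero, .some x _ _, X, _ => X - TrivSqZeroExt.inl x
  | .some x _ _, .zero, X, _ => X - TrivSqZeroExt.inl x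
  | .some x₁ y₁ _, .some x₂ y₂ _, X, Y =>
    if x₁ = x₂ ∧ y₁ = -y₂ then X - TrivSqZeroExt.inl x₁
    else Y - TrivSqZeroExt.inl y₁ -
      TrivSqZeroExt.inl (E.toAffine.slope x₁ x₂ y₁ y₂) * (X - TrivSqZeroExt.inl x₁)

/-- The value at a point of `Ẽ(K[ε])` of the line through `P, Q ∈ E(K)`. The value is meaningful
at affine points only, and lines are used at affine points only. -/
noncomputable def lineAt (P Q : E.toAffine.Point) : DualPoint E → K[ε]
  | .affine X Y _ => lineEval P Q X Y
  | .inf _ => 0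

/-- The value at a point of `Ẽ(K[ε])` of the vertical line through `P ∈ E(K)`. -/
noncomputable def vertAt (P : E.toAffine.Point) : DualPoint E → K[ε] := lineAt P (-P)

/-- Miller's function `h_{i,j}` for `P ∈ E[p]` and the translation `τ` by `-T`, evaluated at a point
of `Ẽ(K[ε])`: it is `(ℓ_{i,j} / v_{i+j}) ∘ τ` if `i + j ≠ p` and `v_i ∘ τ` if `i + j = p`. -/
noncomputable def millerH (p : ℕ) (P T : E.toAffine.Point) (i j : ℕ) (Q : DualPoint E) : K[ε] :=
  if i + j = p then vertAt (i • P) (Q - DualPoint.ofBase T)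
  else lineAt (i • P) (j • P) (Q - DualPoint.ofBase T) *
    (vertAt ((i + j) • P) (Q - DualPoint.ofBase T))⁻¹

end Pairing

/-- `S` is an addition chain for `n`. -/
structure IsAdditionChain (n : ℕ) (S : Finset ℕ) : Prop where
  subset : S ⊆ Finset.Icc 1 n
  mem : n ∈ S
  exists_add : ∀ k ∈ S, 1 < k → ∃ i ∈ S, ∃ j ∈ S, i + j = k

/-- The sequence `C` of steps `i + j ↦ i, j` with `i, j, i + j ∈ S` decomposes the multiset `M` into
ones. A step `i + j ↦ i, j` is recorded as the pair `(i, j)`, and replaces one occurrence of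
`i + j` by `i` and `j`. -/
inductive Decomposes (S : Finset ℕ) : Multiset ℕ → List (ℕ × ℕ) → Prop
  | ones (m : ℕ) : Decomposes S (Multiset.replicate m 1) []
  | step {i j : ℕ} {M : Multiset ℕ} {C : List (ℕ × ℕ)} (hi : i ∈ S) (hj : j ∈ S)
      (hij : i + j ∈ S) (h : Decomposes S (i ::ₘ j ::ₘ M) C) :
      Decomposes S ((i + j) ::ₘ M) ((i, j) :: C)

/-- `C` is an addition chain decomposition of `n`. -/
def IsAdditionChainDecomposition (n : ℕ) (C : List (ℕ × ℕ)) : Prop :=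
  ∃ S, IsAdditionChain n S ∧ Decomposes S {n} C

section Pairing

variable [DecidableEq K] [E.IsShortNF] [E.IsElliptic]

/-- The map `e(P, 𝒪ₖ) = ∏_C h_{i,j}(𝒪ₖ + R) / h_{i,j}(R)` on `E[p] × Θ`, with value `1` if `P` or
`𝒪ₖ` is the point at infinity `𝒪₀`. -/
noncomputable def millerPairing {p : ℕ} (C : List (ℕ × ℕ)) (R T : E.toAffine.Point)
    (P : BaseTorsion E p) (k : K) : K[ε] :=
  if P = 0 ∨ k = 0 then 1
  else (C.map fun s =>
    millerH p P.1 T s.1 s.2 (DualPoint.inf k + DualPoint.ofBase R) *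
      (millerH p P.1 T s.1 s.2 (DualPoint.ofBase R))⁻¹).prod

/-- `ep : Ẽ[p] × Ẽ[p] → μ_p(K[ε])` is bilinear, antisymmetric, trivial on `E[p] × E[p]` and on
`Θ × Θ`, and extends the map `e` on `E[p] × Θ`. -/
structure IsWeilExtension {p : ℕ} [CharP K p] (e : BaseTorsion E p → K → K[ε])
    (ep : DualTorsion E p → DualTorsion E p → rootsOfUnity p K[ε]) : Prop where
  extends_e : ∀ P k, ((ep (baseTorsion P) (thetaTorsion E p k) : K[ε]ˣ) : K[ε]) = e P k
  base_base : ∀ P Q, ep (baseTorsion P) (baseTorsion Q) = 1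
  theta_theta : ∀ j k, ep (thetaTorsion E p j) (thetaTorsion E p k) = 1
  add_left : ∀ P P' Q, ep (P + P') Q = ep P Q * ep P' Q
  add_right : ∀ P Q Q', ep P (Q + Q') = ep P Q * ep P Q'
  antisymm : ∀ P Q, ep P Q = (ep Q P)⁻¹

end Pairing

end DualCurve

/-!
The point `𝒪ₖ` is an infinitesimal translation: `P + 𝒪ₖ` is the image of `P` under `1 + kεD`, where
`D` is the invariant derivation with `Dx = -2y` and `Dy = -(3x² + A)`. Hence
`e(P, 𝒪ₖ) = 1 + kε Df / f`, evaluated at `R - T`, where `f` is the product over the steps of `C` of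
the functions `ℓ_{i,j} / v_{i+j}`. For a single step the logarithmic derivative `D log` is, up to
sign, the slope of `ℓ_{i,j}` plus terms that telescope along the chain and cancel in
characteristic `p`, so `Df / f` is a constant `c(P)`: minus the sum of the slopes of the lines.

The divisor of `f` is `p(P - 𝒪)`. As `c(P)` depends on this divisor alone and `D log` kills `p`-th
powers, `c` is additive on `E[p]`. It is also injective: if `c(P) = 0` with `P ≠ 𝒪`, then
`c(-P) = 0` too, and the functions with divisors `p(P - 𝒪)` and `p(-P - 𝒪)` are both nonconstant
and killed by `D`. The norm to `K[x]` of such a function has degree at least `2p`, whereas their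
product is `(x - x(P))ᵖ` up to a constant, whose norm has degree `2p`. Then
`(P + 𝒪ⱼ, Q + 𝒪ₖ) ↦ 1 + (k c(P) - j c(Q))ε` is the pairing, and it is non-degenerate.
-/

namespace DualCurve

open WeierstrassCurve TrivSqZeroExt Polynomial WeierstrassCurve.Affine.CoordinateRing
open scoped nonZeroDivisors

theorem nsmul_eq_self_of_odd {M : Type*} [AddMonoid M] {a : M} (ha : 2 • a = 0) {n : ℕ}
    (hn : Odd n) : n • a = a := by
  obtain ⟨m, rfl⟩ := hn
  rw [succ_nsmul, mul_nsmul, ha, nsmul_zero, zero_add]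

section LogDerivative

variable {L : Type*} [Field L] {z w : L[ε]}

/-- The logarithmic derivative `b / a` of the dual number `a + bε`, with value `0` if `a = 0`. -/
noncomputable def dlog (z : L[ε]) : L := z.snd / z.fst

theorem dlog_inl (a : L) : dlog (inl a : L[ε]) = 0 := by simp [dlog]

theorem dlog_mul (hz : z.fst ≠ 0) (hw : w.fst ≠ 0) : dlog (z * w) = dlog z + dlog w := by
  simp only [dlog, DualNumber.snd_mul, fst_mul]
  field_simp
  ring

theorem dlog_inv (hz : z.fst ≠ 0) : dlog z⁻¹ = -dlog z := by
  simp only [dlog, snd_inv, fst_inv, smul_eq_mul, MulOpposite.smul_eq_mul_unop,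
    MulOpposite.unop_op]
  field_simp

theorem dlog_pow (hz : z.fst ≠ 0) (n : ℕ) : dlog (z ^ n) = n * dlog z := by
  induction n with
  | zero => simp [dlog]
  | succ n ih =>
    rw [pow_succ, dlog_mul (by simpa only [fst_pow] using pow_ne_zero n hz) hz, ih]
    push_cast
    ring

theorem eq_one_add_inr_dlog (hz : z.fst = 1) : z = 1 + inr (dlog z) := by
  ext <;> simp [dlog, hz]

theorem prod_map_mul_inv {ι : Type*} (l : List ι) (f g : ι → L[ε]) :
    (l.map fun i => f i * (g i)⁻¹).prod = (l.map f).prod * (l.map g).prod⁻¹ := by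
  induction l with
  | nil => simp
  | cons i l ih =>
    simp only [List.map_cons, List.prod_cons, ih, TrivSqZeroExt.mul_inv_rev]
    ring

theorem map_inv_dualNumber {F : Type*} [Field F] (φ : F →+* L[ε]) (f : F) :
    φ f⁻¹ = (φ f)⁻¹ := by
  by_cases hf : f = 0
  · simp [hf]
  · have h : (φ f).fst ≠ 0 :=
      ((isUnit_iff_ne_zero.2 hf).map ((fstHom ℕ L L).toRingHom.comp φ)).ne_zero
    calc φ f⁻¹ = φ f⁻¹ * (φ f * (φ f)⁻¹) := by rw [TrivSqZeroExt.mul_inv_cancel h, mul_one]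
      _ = (φ f)⁻¹ := by rw [← mul_assoc, ← map_mul, inv_mul_cancel₀ hf, map_one, one_mul]

end LogDerivative

section Lines

variable {K : Type*} [Field K] {E : WeierstrassCurve K}

variable (E) in
/-- The right side of `y² = x³ + Ax + B`. -/
noncomputable def cubic : K[X] := X ^ 3 + C E.a₄ * X + C E.a₆

theorem derivative_cubic : derivative (cubic E) = 3 * X ^ 2 + C E.a₄ := by
  simp only [cubic, derivative_add, derivative_mul, derivative_X_pow, derivative_C, derivative_X,
    map_natCast]
  push_cast
  ring

theorem polynomial_eq [E.IsShortNF] : E.toAffine.polynomial = X ^ 2 - C (cubic E) := by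
  simp [Affine.polynomial, cubic]

variable {L : Type*} [Field L] [Algebra K L] {ξ η : L} {P Q : E.toAffine.Point}

/-- The `x`-coordinate `ξ - 2ηkε` of the sum of the point `(ξ, η)` and `𝒪ₖ`. -/
noncomputable def shiftX (ξ η k : L) : L[ε] := inl ξ + inr (-2 * η * k)

variable (E) in
/-- The `y`-coordinate `η - (3ξ² + A)kε` of the sum of the point `(ξ, η)` and `𝒪ₖ`. -/
noncomputable def shiftY (ξ η k : L) : L[ε] := inl η + inr (-aeval ξ (derivative (cubic E)) * k)

theorem fst_shiftX (ξ η k : L) : (shiftX ξ η k).fst = ξ := by simp [shiftX]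

theorem fst_shiftY (ξ η k : L) : (shiftY E ξ η k).fst = η := by simp [shiftY]

theorem aeval_shiftX (k : L) (q : K[X]) :
    aeval (shiftX ξ η k) q = inl (aeval ξ q) + inr (aeval ξ (derivative q) * (-2 * η * k)) := by
  have hinl (q : K[X]) : aeval (inl ξ : L[ε]) q = inl (aeval ξ q) :=
    aeval_algHom_apply (inlAlgHom K L L) ξ q
  rw [shiftX, aeval_add_of_sq_eq_zero _ _ _ (by rw [pow_two, inr_mul_inr]), hinl, hinl,
    inl_mul_inr, smul_eq_mul]

theorem shiftY_sq (h : η ^ 2 = aeval ξ (cubic E)) (k : L) :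
    shiftY E ξ η k ^ 2 = aeval (shiftX ξ η k) (cubic E) := by
  rw [aeval_shiftX]
  ext
  · simpa [shiftY, fst_pow] using h
  · simp only [shiftY, pow_two, DualNumber.snd_mul, fst_add, snd_add, fst_inl, fst_inr, snd_inl,
      snd_inr]
    ring

/-- The slope of the line through `(ξ, η)` and `-P`, with value `0` if `P` is the point at
infinity. -/
noncomputable def chordSlope : E.toAffine.Point → L → L → L
  | .zero, _, _ => 0
  | .some x y _, ξ, η => (η + algebraMap K L y) / (ξ - algebraMap K L x)

theorem chordSlope_zero : chordSlope (0 : E.toAffine.Point) ξ η = 0 := rfl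

theorem derivative_linePolynomial (x y s : K) : derivative (Affine.linePolynomial x y s) = C s := by
  simp [Affine.linePolynomial]

theorem chordSlope_some {x y : K} (h : E.toAffine.Nonsingular x y) {x₁ y₁ s : K}
    (hy : (Affine.linePolynomial x₁ y₁ s).eval x = y) (hξ : ξ ≠ algebraMap K L x) :
    chordSlope (.some x y h) ξ η =
      (η + aeval ξ (Affine.linePolynomial x₁ y₁ s)) / (ξ - algebraMap K L x) -
        algebraMap K L s := by
  have hξ := sub_ne_zero.2 hξ
  simp only [← hy, chordSlope, Affine.linePolynomial, eval_add, eval_mul, eval_sub, eval_C,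
    eval_X, map_add, map_mul, map_sub, aeval_C, aeval_X]
  field_simp
  ring

/-- `ξ` is not the `x`-coordinate of `P`. -/
def IsAway : E.toAffine.Point → L → Prop
  | .zero, _ => True
  | .some x _ _, ξ => ξ ≠ algebraMap K L x

theorem isAway_zero : IsAway (0 : E.toAffine.Point) ξ := trivial

theorem isAway_neg : IsAway (-P) ξ ↔ IsAway P ξ := by
  rcases P with _ | ⟨x, y, _⟩ <;> rfl

@[elab_as_elim]
theorem pair_cases {motive : E.toAffine.Point → E.toAffine.Point → Prop} (P Q : E.toAffine.Point)
    (zero_left : ∀ Q, motive 0 Q) (zero_right : ∀ P, motive P 0) (neg : ∀ P, motive P (-P))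
    (secant : ∀ {x₁ y₁ x₂ y₂ : K} (h₁ : E.toAffine.Nonsingular x₁ y₁)
      (h₂ : E.toAffine.Nonsingular x₂ y₂), ¬ (x₁ = x₂ ∧ y₁ = E.toAffine.negY x₂ y₂) →
      motive (.some x₁ y₁ h₁) (.some x₂ y₂ h₂)) : motive P Q := by
  rcases P with _ | ⟨x₁, y₁, h₁⟩
  · exact zero_left Q
  rcases Q with _ | ⟨x₂, y₂, h₂⟩
  · exact zero_right _
  by_cases h : x₁ = x₂ ∧ y₁ = E.toAffine.negY x₂ y₂
  · obtain ⟨rfl, rfl⟩ := h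
    have key := neg (-.some x₁ y₂ h₂)
    rwa [neg_neg, Affine.Point.neg_some] at key
  · exact secant h₁ h₂ h

variable [DecidableEq K]

/-- The value at `(ξ, η) ∈ A²` of the normalized equation of the line through two points of `E(K)`,
for any `K`-algebra `A`. -/
noncomputable def lineVal {A : Type*} [CommRing A] [Algebra K A] :
    E.toAffine.Point → E.toAffine.Point → A → A → A
  | .zero, .zero, _, _ => 1
  | .zero, .some x _ _, ξ, _ => ξ - algebraMap K A x
  | .some x _ _, .zero, ξ, _ => ξ - algebraMap K A x
  | .some x₁ y₁ _, .some x₂ y₂ _, ξ, η =>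
    if x₁ = x₂ ∧ y₁ = E.toAffine.negY x₂ y₂ then ξ - algebraMap K A x₁
    else η - aeval ξ (Affine.linePolynomial x₁ y₁ (E.toAffine.slope x₁ x₂ y₁ y₂))

/-- The slope of the line through two points of `E(K)`, with value `0` if the line is vertical or
one of the points is the point at infinity. -/
noncomputable def slopeOrZero : E.toAffine.Point → E.toAffine.Point → K
  | .some x₁ y₁ _, .some x₂ y₂ _ =>
    if x₁ = x₂ ∧ y₁ = E.toAffine.negY x₂ y₂ then 0 else E.toAffine.slope x₁ x₂ y₁ y₂
  | _, _ => 0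

theorem map_lineVal {A B : Type*} [CommRing A] [Algebra K A] [CommRing B] [Algebra K B]
    (φ : A →ₐ[K] B) (P Q : E.toAffine.Point) (ξ η : A) :
    φ (lineVal P Q ξ η) = lineVal P Q (φ ξ) (φ η) := by
  rcases P with _ | ⟨x₁, y₁, h₁⟩ <;> rcases Q with _ | ⟨x₂, y₂, h₂⟩ <;>
    simp only [lineVal, map_one, map_sub, AlgHom.commutes]
  split_ifs
  · simp only [map_sub, AlgHom.commutes]
  · rw [map_sub, aeval_algHom_apply]

section Vertical

variable {A : Type*} [CommRing A] [Algebra K A]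

theorem lineVal_neg_some {x y : K} (h : E.toAffine.Nonsingular x y) (ξ η : A) :
    lineVal (.some x y h) (-.some x y h) ξ η = ξ - algebraMap K A x := by
  simp only [Affine.Point.neg_some, lineVal, Affine.negY_negY, and_self, if_true]

theorem lineVal_zero_left (P : E.toAffine.Point) (ξ η : A) :
    lineVal 0 P ξ η = lineVal P (-P) ξ η := by
  rcases P with _ | ⟨x, y, h⟩
  · rfl
  · exact (lineVal_neg_some h ξ η).symm

theorem lineVal_zero_right (P : E.toAffine.Point) (ξ η : A) :
    lineVal P 0 ξ η = lineVal P (-P) ξ η := by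
  rcases P with _ | ⟨x, y, h⟩
  · rfl
  · exact (lineVal_neg_some h ξ η).symm

theorem slopeOrZero_zero_left (P : E.toAffine.Point) : slopeOrZero 0 P = 0 := rfl

theorem slopeOrZero_zero_right (P : E.toAffine.Point) : slopeOrZero P 0 = 0 := by
  rcases P with _ | _ <;> rfl

theorem slopeOrZero_neg (P : E.toAffine.Point) : slopeOrZero P (-P) = 0 := by
  rcases P with _ | ⟨x, y, h⟩
  · rfl
  · simp only [Affine.Point.neg_some, slopeOrZero, Affine.negY_negY, and_self, if_true]

theorem lineVal_neg_ne_zero (hP : IsAway P ξ) : lineVal P (-P) ξ η ≠ 0 := by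
  rcases P with _ | ⟨x, y, h⟩
  · exact one_ne_zero
  · rw [lineVal_neg_some]
    exact sub_ne_zero.2 hP

theorem dlog_lineVal_neg [E.IsShortNF] (hP : IsAway P ξ) (k : L) :
    dlog (lineVal P (-P) (shiftX ξ η k) (shiftY E ξ η k)) =
      -k * (chordSlope P ξ η + chordSlope (-P) ξ η) := by
  rcases P with _ | ⟨x, y, h⟩
  · rw [← Affine.Point.zero_def, neg_zero, chordSlope_zero, add_zero, mul_zero]
    exact dlog_inl 1
  · have hξ : ξ - algebraMap K L x ≠ 0 := sub_ne_zero.2 hP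
    rw [lineVal_neg_some, Affine.Point.neg_some]
    simp only [dlog, shiftX, algebraMap_eq_inl', chordSlope, DualPoint.negY_eq, map_neg, fst_sub,
      snd_sub, fst_add, snd_add, fst_inl, fst_inr, snd_inl, snd_inr, add_zero, zero_add, sub_zero]
    field_simp
    ring

end Vertical

section Secant

variable {x₁ y₁ x₂ y₂ : K}

theorem eval_linePolynomial_slope (h₁ : E.toAffine.Equation x₁ y₁)
    (h₂ : E.toAffine.Equation x₂ y₂) (h : ¬ (x₁ = x₂ ∧ y₁ = E.toAffine.negY x₂ y₂)) :
    (Affine.linePolynomial x₁ y₁ (E.toAffine.slope x₁ x₂ y₁ y₂)).eval x₂ = y₂ := by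
  simp only [Affine.linePolynomial, eval_add, eval_mul, eval_sub, eval_C, eval_X]
  by_cases hx : x₁ = x₂
  · rw [hx, sub_self, mul_zero, zero_add, Affine.Y_eq_of_Y_ne h₁ h₂ hx fun e => h ⟨hx, e⟩]
  · rw [Affine.slope_of_X_ne hx]
    field_simp [sub_ne_zero.2 hx]
    ring

theorem cubic_eq_linePolynomial_sq_add [E.IsShortNF] (h₁ : E.toAffine.Equation x₁ y₁)
    (h₂ : E.toAffine.Equation x₂ y₂) (h : ¬ (x₁ = x₂ ∧ y₁ = E.toAffine.negY x₂ y₂)) :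
    cubic E = Affine.linePolynomial x₁ y₁ (E.toAffine.slope x₁ x₂ y₁ y₂) ^ 2 +
      (X - C x₁) * (X - C x₂) *
        (X - C (E.toAffine.addX x₁ x₂ (E.toAffine.slope x₁ x₂ y₁ y₂))) := by
  have key := Affine.addPolynomial_slope h₁ h₂ h
  rw [Affine.addPolynomial, polynomial_eq, eval_sub, eval_pow, eval_X, eval_C] at key
  linear_combination -key

variable {h₁ : E.toAffine.Nonsingular x₁ y₁} {h₂ : E.toAffine.Nonsingular x₂ y₂}

theorem exists_neg_add_eq_some (h : ¬ (x₁ = x₂ ∧ y₁ = E.toAffine.negY x₂ y₂)) :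
    ∃ x₃ y₃ h₃, -(.some x₁ y₁ h₁ + .some x₂ y₂ h₂ : E.toAffine.Point) = .some x₃ y₃ h₃ ∧
      x₃ = E.toAffine.addX x₁ x₂ (E.toAffine.slope x₁ x₂ y₁ y₂) ∧
      (Affine.linePolynomial x₁ y₁ (E.toAffine.slope x₁ x₂ y₁ y₂)).eval x₃ = y₃ := by
  refine ⟨_, _, Affine.nonsingular_negAdd h₁ h₂ h, ?_, rfl, ?_⟩
  · simp only [Affine.Point.add_some h, Affine.Point.neg_some, Affine.addY, Affine.negY_negY]
  · simp only [Affine.linePolynomial, Affine.negAddY, eval_add, eval_mul, eval_sub, eval_C, eval_X]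

theorem lineVal_some {A : Type*} [CommRing A] [Algebra K A]
    (h : ¬ (x₁ = x₂ ∧ y₁ = E.toAffine.negY x₂ y₂)) (ξ η : A) :
    lineVal (.some x₁ y₁ h₁) (.some x₂ y₂ h₂) ξ η =
      η - aeval ξ (Affine.linePolynomial x₁ y₁ (E.toAffine.slope x₁ x₂ y₁ y₂)) :=
  if_neg h

theorem slopeOrZero_some (h : ¬ (x₁ = x₂ ∧ y₁ = E.toAffine.negY x₂ y₂)) :
    slopeOrZero (.some x₁ y₁ h₁) (.some x₂ y₂ h₂) = E.toAffine.slope x₁ x₂ y₁ y₂ :=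
  if_neg h

theorem dlog_lineVal_some (h : ¬ (x₁ = x₂ ∧ y₁ = E.toAffine.negY x₂ y₂)) (k : L) :
    dlog (lineVal (.some x₁ y₁ h₁) (.some x₂ y₂ h₂) (shiftX ξ η k) (shiftY E ξ η k)) =
      k * ((2 * algebraMap K L (E.toAffine.slope x₁ x₂ y₁ y₂) * η -
        aeval ξ (derivative (cubic E))) / lineVal (.some x₁ y₁ h₁) (.some x₂ y₂ h₂) ξ η) := by
  rw [lineVal_some h, lineVal_some h, aeval_shiftX, derivative_linePolynomial, aeval_C, dlog,
    ← mul_div_assoc]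
  congr 1
  · simp only [shiftY, snd_sub, snd_add, snd_inl, snd_inr]
    ring
  · simp only [fst_sub, fst_shiftY, fst_add, fst_inl, fst_inr, add_zero]

variable [E.IsShortNF]

theorem lineVal_some_mul (h : ¬ (x₁ = x₂ ∧ y₁ = E.toAffine.negY x₂ y₂))
    (hη : η ^ 2 = aeval ξ (cubic E)) :
    lineVal (.some x₁ y₁ h₁) (.some x₂ y₂ h₂) ξ η *
        (η + aeval ξ (Affine.linePolynomial x₁ y₁ (E.toAffine.slope x₁ x₂ y₁ y₂))) =
      (ξ - algebraMap K L x₁) * (ξ - algebraMap K L x₂) *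
        (ξ - algebraMap K L (E.toAffine.addX x₁ x₂ (E.toAffine.slope x₁ x₂ y₁ y₂))) := by
  rw [cubic_eq_linePolynomial_sq_add h₁.1 h₂.1 h] at hη
  simp only [map_add, map_mul, map_sub, map_pow, aeval_X, aeval_C] at hη
  rw [lineVal_some h]
  linear_combination hη

theorem chordSlope_add_chordSlope_add_chordSlope
    (h : ¬ (x₁ = x₂ ∧ y₁ = E.toAffine.negY x₂ y₂)) (hη : η ^ 2 = aeval ξ (cubic E))
    (hP : IsAway (.some x₁ y₁ h₁) ξ) (hQ : IsAway (.some x₂ y₂ h₂) ξ)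
    (hPQ : IsAway (.some x₁ y₁ h₁ + .some x₂ y₂ h₂ : E.toAffine.Point) ξ) :
    chordSlope (.some x₁ y₁ h₁) ξ η + chordSlope (.some x₂ y₂ h₂) ξ η +
        chordSlope (-(.some x₁ y₁ h₁ + .some x₂ y₂ h₂ : E.toAffine.Point)) ξ η =
      (aeval ξ (derivative (cubic E)) - 2 * algebraMap K L (E.toAffine.slope x₁ x₂ y₁ y₂) * η) /
          lineVal (.some x₁ y₁ h₁) (.some x₂ y₂ h₂) ξ η -
        algebraMap K L (E.toAffine.slope x₁ x₂ y₁ y₂) := by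
  obtain ⟨x₃, y₃, h₃, hadd, hx₃, hy₃⟩ := exists_neg_add_eq_some (h₁ := h₁) (h₂ := h₂) h
  have hmul := lineVal_some_mul (h₁ := h₁) (h₂ := h₂) h hη
  have hcubic := cubic_eq_linePolynomial_sq_add h₁.1 h₂.1 h
  have hline := lineVal_some (h₁ := h₁) (h₂ := h₂) h ξ η
  have hy₁ : (Affine.linePolynomial x₁ y₁ (E.toAffine.slope x₁ x₂ y₁ y₂)).eval x₁ = y₁ := by
    simp [Affine.linePolynomial]
  rw [← isAway_neg, hadd] at hPQ
  rw [hadd, chordSlope_some h₁ hy₁ hP,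
    chordSlope_some h₂ (eval_linePolynomial_slope h₁.1 h₂.1 h) hQ, chordSlope_some h₃ hy₃ hPQ]
  rw [← hx₃] at hmul hcubic
  replace hP := sub_ne_zero.2 hP
  replace hQ := sub_ne_zero.2 hQ
  replace hPQ := sub_ne_zero.2 hPQ
  have hne := left_ne_zero_of_mul (hmul.trans_ne (mul_ne_zero (mul_ne_zero hP hQ) hPQ))
  have hderiv := congrArg (fun f => aeval ξ (derivative f)) hcubic
  simp only [map_add, derivative_mul, derivative_pow, map_sub, derivative_X, derivative_C,
    derivative_linePolynomial, map_mul, aeval_X, aeval_C, map_pow, map_natCast, map_one, map_zero]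
    at hderiv
  rw [hderiv]
  generalize ξ - algebraMap K L x₁ = a, ξ - algebraMap K L x₂ = b, ξ - algebraMap K L x₃ = c at *
  field_simp
  push_cast
  linear_combination (b * c + a * c + a * b) * hmul -
    2 * a * b * c * algebraMap K L (E.toAffine.slope x₁ x₂ y₁ y₂) * hline

end Secant

variable [E.IsShortNF]

theorem lineVal_ne_zero (hη : η ^ 2 = aeval ξ (cubic E)) (hP : IsAway P ξ) (hQ : IsAway Q ξ)
    (hPQ : IsAway (P + Q) ξ) : lineVal P Q ξ η ≠ 0 := by
  induction P, Q using pair_cases with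
  | zero_left Q => rw [lineVal_zero_left]; exact lineVal_neg_ne_zero hQ
  | zero_right P => rw [lineVal_zero_right]; exact lineVal_neg_ne_zero hP
  | neg P => exact lineVal_neg_ne_zero hP
  | secant h₁ h₂ h =>
    obtain ⟨x₃, y₃, h₃, hadd, rfl, -⟩ := exists_neg_add_eq_some (h₁ := h₁) (h₂ := h₂) h
    rw [← isAway_neg, hadd] at hPQ
    exact left_ne_zero_of_mul ((lineVal_some_mul h hη).trans_ne (mul_ne_zero
      (mul_ne_zero (sub_ne_zero.2 hP) (sub_ne_zero.2 hQ)) (sub_ne_zero.2 hPQ)))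

theorem dlog_lineVal (hη : η ^ 2 = aeval ξ (cubic E)) (hP : IsAway P ξ) (hQ : IsAway Q ξ)
    (hPQ : IsAway (P + Q) ξ) (k : L) :
    dlog (lineVal P Q (shiftX ξ η k) (shiftY E ξ η k)) =
      -k * (algebraMap K L (slopeOrZero P Q) + chordSlope P ξ η + chordSlope Q ξ η +
        chordSlope (-(P + Q)) ξ η) := by
  induction P, Q using pair_cases with
  | zero_left Q =>
    rw [lineVal_zero_left, dlog_lineVal_neg hQ, slopeOrZero_zero_left, map_zero,
      chordSlope_zero, zero_add Q]
    ring
  | zero_right P =>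
    rw [lineVal_zero_right, dlog_lineVal_neg hP, slopeOrZero_zero_right, map_zero,
      chordSlope_zero, add_zero P]
    ring
  | neg P =>
    rw [dlog_lineVal_neg hP, slopeOrZero_neg, map_zero, add_neg_cancel, neg_zero, chordSlope_zero]
    ring
  | secant h₁ h₂ h =>
    rw [dlog_lineVal_some h, slopeOrZero_some h, add_assoc _ _ (chordSlope _ _ _), add_assoc,
      ← add_assoc (chordSlope _ _ _), chordSlope_add_chordSlope_add_chordSlope h hη hP hQ hPQ]
    ring

end Lines

section Miller

variable {K : Type*} [Field K] [DecidableEq K] {E : WeierstrassCurve K}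

section Values

variable {A B : Type*} [CommRing A] [Inv A] [Algebra K A] [CommRing B] [Inv B] [Algebra K B]

/-- The value at `(ξ, η) ∈ A²` of the quotient of the line through `P` and `Q` by the vertical line
through `P + Q`. -/
noncomputable def lineQuot (P Q : E.toAffine.Point) (ξ η : A) : A :=
  lineVal P Q ξ η * (lineVal (P + Q) (-(P + Q)) ξ η)⁻¹

/-- The value at `(ξ, η) ∈ A²` of Miller's function for `P` and the decomposition `C`, the product
of the `lineQuot (iP) (jP)` over the steps `i + j ↦ i, j`. -/
noncomputable def millerVal (C : List (ℕ × ℕ)) (P : E.toAffine.Point) (ξ η : A) : A :=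
  (C.map fun s => lineQuot (s.1 • P) (s.2 • P) ξ η).prod

theorem millerVal_nil (P : E.toAffine.Point) (ξ η : A) : millerVal [] P ξ η = 1 := rfl

theorem millerVal_cons (i j : ℕ) (C : List (ℕ × ℕ)) (P : E.toAffine.Point) (ξ η : A) :
    millerVal ((i, j) :: C) P ξ η = lineQuot (i • P) (j • P) ξ η * millerVal C P ξ η := rfl

variable {φ : A →ₐ[K] B}

theorem map_lineQuot (hφ : ∀ a, φ a⁻¹ = (φ a)⁻¹) (P Q : E.toAffine.Point) (ξ η : A) :
    φ (lineQuot P Q ξ η) = lineQuot P Q (φ ξ) (φ η) := by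
  rw [lineQuot, map_mul, hφ, map_lineVal, map_lineVal, lineQuot]

theorem map_millerVal (hφ : ∀ a, φ a⁻¹ = (φ a)⁻¹) (C : List (ℕ × ℕ)) (P : E.toAffine.Point)
    (ξ η : A) : φ (millerVal C P ξ η) = millerVal C P (φ ξ) (φ η) := by
  simp only [millerVal, map_list_prod, List.map_map, Function.comp_def, map_lineQuot hφ]

end Values

/-- The sum over the steps `i + j ↦ i, j` in `C` of the slopes of the lines through `iP` and `jP`.
This is the invariant of `P` that the pairing with `Θ` computes. -/
noncomputable def slopeSum (C : List (ℕ × ℕ)) (P : E.toAffine.Point) : K :=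
  (C.map fun s => slopeOrZero (s.1 • P) (s.2 • P)).sum

theorem slopeSum_cons (i j : ℕ) (C : List (ℕ × ℕ)) (P : E.toAffine.Point) :
    slopeSum ((i, j) :: C) P = slopeOrZero (i • P) (j • P) + slopeSum C P := rfl

theorem slopeSum_zero (C : List (ℕ × ℕ)) : slopeSum C (0 : E.toAffine.Point) = 0 := by
  simp [slopeSum, slopeOrZero_zero_left]

variable {L : Type*} [Field L] [Algebra K L]

theorem fst_lineVal_shift (P Q : E.toAffine.Point) (ξ η k : L) :
    (lineVal P Q (shiftX ξ η k) (shiftY E ξ η k)).fst = lineVal P Q ξ η := by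
  have h := map_lineVal (fstHom K L L) P Q (shiftX ξ η k) (shiftY E ξ η k)
  rwa [fstHom_apply, fstHom_apply, fstHom_apply, fst_shiftX, fst_shiftY] at h

theorem fst_lineQuot_shift (P Q : E.toAffine.Point) (ξ η k : L) :
    (lineQuot P Q (shiftX ξ η k) (shiftY E ξ η k)).fst = lineQuot P Q ξ η := by
  simp only [lineQuot, fst_mul, fst_inv, fst_lineVal_shift]

theorem fst_millerVal_shift (C : List (ℕ × ℕ)) (P : E.toAffine.Point) (ξ η k : L) :
    (millerVal C P (shiftX ξ η k) (shiftY E ξ η k)).fst = millerVal C P ξ η := by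
  have h := map_millerVal (φ := fstHom K L L) fst_inv C P (shiftX ξ η k) (shiftY E ξ η k)
  rwa [fstHom_apply, fstHom_apply, fstHom_apply, fst_shiftX, fst_shiftY] at h

variable [E.IsShortNF] {ξ η : L} {P Q : E.toAffine.Point}

theorem lineQuot_ne_zero (hη : η ^ 2 = aeval ξ (cubic E)) (hP : IsAway P ξ) (hQ : IsAway Q ξ)
    (hPQ : IsAway (P + Q) ξ) : lineQuot P Q ξ η ≠ 0 :=
  mul_ne_zero (lineVal_ne_zero hη hP hQ hPQ) (inv_ne_zero (lineVal_neg_ne_zero hPQ))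

theorem millerVal_ne_zero (hη : η ^ 2 = aeval ξ (cubic E)) (hP : ∀ n : ℕ, IsAway (n • P) ξ)
    (C : List (ℕ × ℕ)) : millerVal C P ξ η ≠ 0 := by
  refine List.prod_ne_zero fun h => ?_
  obtain ⟨s, -, hs⟩ := List.mem_map.1 h
  exact lineQuot_ne_zero hη (hP s.1) (hP s.2) (add_smul s.1 s.2 P ▸ hP _) hs

theorem dlog_lineQuot (hη : η ^ 2 = aeval ξ (cubic E)) (hP : IsAway P ξ) (hQ : IsAway Q ξ)
    (hPQ : IsAway (P + Q) ξ) (k : L) :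
    dlog (lineQuot P Q (shiftX ξ η k) (shiftY E ξ η k)) =
      -k * (algebraMap K L (slopeOrZero P Q) + chordSlope P ξ η + chordSlope Q ξ η -
        chordSlope (P + Q) ξ η) := by
  have hline : (lineVal P Q (shiftX ξ η k) (shiftY E ξ η k)).fst ≠ 0 := by
    rw [fst_lineVal_shift]
    exact lineVal_ne_zero hη hP hQ hPQ
  have hvert : (lineVal (P + Q) (-(P + Q)) (shiftX ξ η k) (shiftY E ξ η k)).fst ≠ 0 := by
    rw [fst_lineVal_shift]
    exact lineVal_neg_ne_zero hPQ
  rw [lineQuot, dlog_mul hline (by rw [fst_inv]; exact inv_ne_zero hvert), dlog_inv hvert,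
    dlog_lineVal hη hP hQ hPQ, dlog_lineVal_neg hPQ]
  ring

theorem dlog_millerVal_of_decomposes (hη : η ^ 2 = aeval ξ (cubic E))
    (hP : ∀ n : ℕ, IsAway (n • P) ξ) (k : L) {S : Finset ℕ} {M : Multiset ℕ} {C : List (ℕ × ℕ)}
    (hC : Decomposes S M C) :
    dlog (millerVal C P (shiftX ξ η k) (shiftY E ξ η k)) =
      -k * (algebraMap K L (slopeSum C P) + M.sum * chordSlope P ξ η -
        (M.map fun n => chordSlope (n • P) ξ η).sum) := by
  induction hC with
  | ones m => simp [slopeSum, millerVal_nil, dlog]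
  | @step i j M C _ _ _ _ ih =>
    have hij : IsAway (i • P + j • P) ξ := add_smul i j P ▸ hP (i + j)
    have hquot : (lineQuot (i • P) (j • P) (shiftX ξ η k) (shiftY E ξ η k)).fst ≠ 0 := by
      rw [fst_lineQuot_shift]
      exact lineQuot_ne_zero hη (hP i) (hP j) hij
    have hmiller : (millerVal C P (shiftX ξ η k) (shiftY E ξ η k)).fst ≠ 0 := by
      rw [fst_millerVal_shift]
      exact millerVal_ne_zero hη hP C
    rw [millerVal_cons, dlog_mul hquot hmiller, ih, dlog_lineQuot hη (hP i) (hP j) hij,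
      slopeSum_cons, ← add_smul]
    simp only [Multiset.sum_cons, Multiset.map_cons, map_add, Nat.cast_add]
    ring

theorem dlog_millerVal {p : ℕ} [CharP L p] (hη : η ^ 2 = aeval ξ (cubic E))
    (hP : ∀ n : ℕ, IsAway (n • P) ξ) (hpP : p • P = 0) {S : Finset ℕ} {C : List (ℕ × ℕ)}
    (hC : Decomposes S {p} C) (k : L) :
    dlog (millerVal C P (shiftX ξ η k) (shiftY E ξ η k)) = -k * algebraMap K L (slopeSum C P) := by
  rw [dlog_millerVal_of_decomposes hη hP k hC, Multiset.sum_singleton, Multiset.map_singleton,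
    Multiset.sum_singleton, hpP, CharP.cast_eq_zero, chordSlope_zero, zero_mul, add_zero, sub_zero]

theorem millerVal_mul_inv {p : ℕ} [CharP L p] (hη : η ^ 2 = aeval ξ (cubic E))
    (hP : ∀ n : ℕ, IsAway (n • P) ξ) (hpP : p • P = 0) {S : Finset ℕ} {C : List (ℕ × ℕ)}
    (hC : Decomposes S {p} C) (k : L) :
    millerVal C P (shiftX ξ η k) (shiftY E ξ η k) *
        (millerVal C P (shiftX ξ η 0) (shiftY E ξ η 0))⁻¹ =
      1 + inr (-(k * algebraMap K L (slopeSum C P))) := by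
  have hfst (k : L) : (millerVal C P (shiftX ξ η k) (shiftY E ξ η k)).fst ≠ 0 := by
    rw [fst_millerVal_shift]
    exact millerVal_ne_zero hη hP C
  have hone : (millerVal C P (shiftX ξ η k) (shiftY E ξ η k) *
      (millerVal C P (shiftX ξ η 0) (shiftY E ξ η 0))⁻¹).fst = 1 := by
    rw [fst_mul, fst_inv, fst_millerVal_shift, fst_millerVal_shift]
    exact mul_inv_cancel₀ (millerVal_ne_zero hη hP C)
  have hdlog := dlog_millerVal hη hP hpP hC
  refine (eq_one_add_inr_dlog hone).trans ?_
  rw [dlog_mul (hfst k) (by rw [fst_inv]; exact inv_ne_zero (hfst 0)), dlog_inv (hfst 0), hdlog,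
    hdlog, neg_zero, zero_mul, neg_zero, add_zero, neg_mul]

end Miller

section Pairing

variable {K : Type*} [Field K] [DecidableEq K] {E : WeierstrassCurve K}

theorem isAway_of_smul_eq_zero {n : ℕ} {P : E.toAffine.Point} {x y : K}
    {h : E.toAffine.Nonsingular x y} (hP : n • P = 0)
    (hxy : n • (.some x y h : E.toAffine.Point) ≠ 0) : IsAway P x := by
  rcases P with _ | ⟨x', y', h'⟩
  · exact isAway_zero
  · rintro rfl
    rcases Affine.Point.X_eq_iff (h₁ := h) (h₂ := h') |>.1 rfl with e | e
    · exact hxy (by rw [e, hP])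
    · exact hxy (by rw [e, smul_neg, hP, neg_zero])

variable [E.IsShortNF]

theorem lineEval_eq_lineVal (P Q : E.toAffine.Point) (x y : K[ε]) :
    lineEval P Q x y = lineVal P Q x y := by
  rcases P with _ | ⟨x₁, y₁, h₁⟩ <;> rcases Q with _ | ⟨x₂, y₂, h₂⟩ <;> try rfl
  simp only [lineEval, lineVal, DualPoint.negY_eq, Affine.linePolynomial, map_add, map_mul,
    map_sub, aeval_C, aeval_X, algebraMap_eq_inl]
  split_ifs <;> ring

theorem translate_some {x y : K} (h : E.toAffine.Nonsingular x y) (k : K) :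
    ∃ h', DualPoint.translate (.some x y h) k = .affine (shiftX x y k) (shiftY E x y k) h' := by
  have hx : inl x - 2 * inl y * kEps k = shiftX x y k := by
    ext <;> simp [shiftX, DualPoint.fst_two, mul_comm]
  have hy : inl y - (3 * inl x ^ 2 + inl E.a₄) * kEps k = shiftY E x y k := by
    ext <;> simp [shiftY, derivative_cubic, DualPoint.fst_three]
    ring
  exact ⟨hx ▸ hy ▸ equation_translate (h.1.map (inlHom K K)) k, DualPoint.affine_congr hx hy⟩

theorem lineAt_translate_some {x y : K} (h : E.toAffine.Nonsingular x y) (k : K)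
    (P Q : E.toAffine.Point) :
    lineAt P Q (DualPoint.translate (.some x y h) k) =
      lineVal P Q (shiftX x y k) (shiftY E x y k) := by
  obtain ⟨h', e⟩ := translate_some h k
  rw [e, lineAt, lineEval_eq_lineVal]

variable [E.IsElliptic]

theorem inf_add_ofBase_sub_ofBase (k : K) (R T : E.toAffine.Point) :
    DualPoint.inf k + DualPoint.ofBase R - DualPoint.ofBase T = DualPoint.translate (R - T) k := by
  rw [sub_eq_add_neg, ← DualPoint.translate_zero_right R, ← DualPoint.translate_zero_right T,
    ← DualPoint.translate_zero, DualPoint.neg_translate, DualPoint.translate_add_translate,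
    DualPoint.translate_add_translate]
  simp [sub_eq_add_neg]

theorem millerH_eq_lineQuot {p : ℕ} {P R T : E.toAffine.Point} (hP : p • P = 0) {x y : K}
    {h : E.toAffine.Nonsingular x y} (hRT : R - T = .some x y h) (i j : ℕ) (k : K) :
    millerH p P T i j (DualPoint.inf k + DualPoint.ofBase R) =
      lineQuot (i • P) (j • P) (shiftX x y k) (shiftY E x y k) := by
  simp only [millerH, inf_add_ofBase_sub_ofBase, hRT, vertAt, lineAt_translate_some, lineQuot]
  split_ifs with hij
  · have hadd : i • P + j • P = 0 := by rw [← add_smul, hij, hP]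
    rw [hadd, lineVal_zero_left, neg_zero, ← eq_neg_of_add_eq_zero_right hadd]
    have hone : lineVal (0 : E.toAffine.Point) (-0) (shiftX x y k) (shiftY E x y k) = 1 := rfl
    rw [hone, TrivSqZeroExt.inv_one, mul_one]
  · rw [add_smul]

theorem millerPairing_eq {p : ℕ} [CharP K p] {R T : E.toAffine.Point} (hR : p • R = 0)
    (hT : p • T ≠ 0) {S : Finset ℕ} {C : List (ℕ × ℕ)} (hC : Decomposes S {p} C)
    (P : BaseTorsion E p) (k : K) :
    millerPairing C R T P k = 1 + inr (-(k * slopeSum C P.1)) := by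
  have hP : p • P.1 = 0 := AddSubgroup.torsionBy.nsmul_iff.1 P.2
  rw [millerPairing]
  split_ifs with h0
  · rcases h0 with rfl | rfl
    · simp [slopeSum_zero]
    · simp
  have hRT : p • (R - T) ≠ 0 := by rwa [smul_sub, hR, zero_sub, neg_ne_zero]
  rcases hxy : R - T with _ | ⟨x, y, h⟩
  · exact absurd (hxy ▸ smul_zero p) hRT
  have hη : y ^ 2 = aeval x (cubic E) := by
    simpa [cubic] using (Affine.equation_iff ..).1 h.1
  have haway (n : ℕ) : IsAway (n • P.1) x :=
    isAway_of_smul_eq_zero (by rw [smul_comm, hP, smul_zero]) (hxy ▸ hRT)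
  have hH (k : K) (s : ℕ × ℕ) := millerH_eq_lineQuot hP hxy s.1 s.2 k
  have hH₀ (s : ℕ × ℕ) : millerH p P.1 T s.1 s.2 (DualPoint.ofBase R) =
      lineQuot (s.1 • P.1) (s.2 • P.1) (shiftX x y 0) (shiftY E x y 0) := by
    rw [← hH 0 s]
    exact congrArg _ (zero_add _).symm
  simp only [hH k, hH₀, prod_map_mul_inv]
  exact millerVal_mul_inv hη haway hP hC k

end Pairing

section Derivation

variable {K : Type*} [Field K] (E : WeierstrassCurve K)

/-- The coordinate function `x` in the function field of `E`. -/
noncomputable def genX : E.toAffine.FunctionField :=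
  algebraMap E.toAffine.CoordinateRing _ (mk E.toAffine (C X))

/-- The coordinate function `y` in the function field of `E`. -/
noncomputable def genY : E.toAffine.FunctionField :=
  algebraMap E.toAffine.CoordinateRing _ (mk E.toAffine X)

theorem aeval_genX (q : K[X]) :
    aeval (genX E) q = algebraMap _ E.toAffine.FunctionField (mk E.toAffine (C q)) := by
  induction q using Polynomial.induction_on with
  | C a =>
    rw [aeval_C]
    rfl
  | add p q hp hq => simp only [map_add, hp, hq]
  | monomial n a _ =>
    rw [map_mul, map_pow, aeval_X, aeval_C, map_mul, map_pow, map_mul, map_mul, map_pow, map_pow]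
    rfl

theorem algebraMap_smul_basis (u v : K[X]) :
    algebraMap _ E.toAffine.FunctionField (u • 1 + v • mk E.toAffine X) =
      aeval (genX E) u + aeval (genX E) v * genY E := by
  rw [Affine.CoordinateRing.smul, Affine.CoordinateRing.smul, mul_one, map_add, map_mul,
    aeval_genX, aeval_genX, genY]

variable [E.IsShortNF]

theorem genY_sq : genY E ^ 2 = aeval (genX E) (cubic E) := by
  have h : mk E.toAffine (X ^ 2 - C (cubic E)) = 0 := by
    rw [← polynomial_eq]
    exact AdjoinRoot.mk_self
  rw [map_sub, map_pow, sub_eq_zero] at h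
  rw [genY, ← map_pow, h, aeval_genX]

theorem eval₂_shiftY_genY :
    E.toAffine.polynomial.eval₂ (aeval (shiftX (genX E) (genY E) 1) : K[X] →ₐ[K] _)
      (shiftY E (genX E) (genY E) 1) = 0 := by
  simp only [polynomial_eq, eval₂_sub, eval₂_pow, eval₂_X, eval₂_C, shiftY_sq (genY_sq E)]
  exact sub_self _

/-- The homomorphism `f ↦ f + ε Df` on the coordinate ring, for the invariant derivation `D` with
`Dx = -2y` and `Dy = -(3x² + A)`: it evaluates `f` at the sum of the generic point and `𝒪₁`. -/
noncomputable def coordDerivHom : E.toAffine.CoordinateRing →ₐ[K] E.toAffine.FunctionField[ε] :=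
  AdjoinRoot.liftAlgHom _ (aeval (shiftX (genX E) (genY E) 1)) (shiftY E (genX E) (genY E) 1)
    (eval₂_shiftY_genY E)

theorem coordDerivHom_smul_basis (u v : K[X]) :
    coordDerivHom E (u • 1 + v • mk E.toAffine X) = aeval (shiftX (genX E) (genY E) 1) u +
      aeval (shiftX (genX E) (genY E) 1) v * shiftY E (genX E) (genY E) 1 := by
  have hC (q : K[X]) : coordDerivHom E (mk E.toAffine (C q)) =
      aeval (shiftX (genX E) (genY E) 1) q := AdjoinRoot.lift_of (eval₂_shiftY_genY E)
  have hY : coordDerivHom E (mk E.toAffine X) = shiftY E (genX E) (genY E) 1 :=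
    AdjoinRoot.lift_root (eval₂_shiftY_genY E)
  rw [Affine.CoordinateRing.smul, Affine.CoordinateRing.smul, mul_one, map_add, map_mul, hC, hC, hY]

theorem fst_coordDerivHom (a : E.toAffine.CoordinateRing) :
    (coordDerivHom E a).fst = algebraMap _ _ a := by
  obtain ⟨u, v, rfl⟩ := exists_smul_basis_eq a
  rw [coordDerivHom_smul_basis, algebraMap_smul_basis, fst_add, fst_mul, fst_shiftY, aeval_shiftX,
    aeval_shiftX]
  simp only [fst_add, fst_inl, fst_inr, add_zero]

theorem snd_coordDerivHom_smul_basis (u v : K[X]) :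
    (coordDerivHom E (u • 1 + v • mk E.toAffine X)).snd =
      algebraMap _ _ ((-(2 * derivative v * cubic E + v * derivative (cubic E))) • 1 +
        (-2 * derivative u) • mk E.toAffine X) := by
  rw [coordDerivHom_smul_basis, algebraMap_smul_basis, aeval_shiftX, aeval_shiftX, shiftY]
  simp only [snd_add, DualNumber.snd_mul, fst_add, fst_inl, fst_inr, snd_inl, snd_inr, map_neg,
    map_add, map_mul, ← genY_sq, map_ofNat]
  ring

theorem isUnit_coordDerivHom (a : E.toAffine.CoordinateRing⁰) : IsUnit (coordDerivHom E a) := by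
  rw [isUnit_iff_isUnit_fst, fst_coordDerivHom, isUnit_iff_ne_zero]
  exact IsFractionRing.to_map_ne_zero_of_mem_nonZeroDivisors a.2

/-- The homomorphism `f ↦ f + ε Df` on the function field, for the invariant derivation `D` with
`Dx = -2y` and `Dy = -(3x² + A)`. -/
noncomputable def derivHom : E.toAffine.FunctionField →ₐ[K] E.toAffine.FunctionField[ε] :=
  IsLocalization.liftAlgHom (isUnit_coordDerivHom E)

theorem derivHom_algebraMap (a : E.toAffine.CoordinateRing) :
    derivHom E (algebraMap _ _ a) = coordDerivHom E a :=
  IsLocalization.lift_eq (isUnit_coordDerivHom E) a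

theorem fst_derivHom (f : E.toAffine.FunctionField) : (derivHom E f).fst = f := by
  have h : ((fstHom K E.toAffine.FunctionField E.toAffine.FunctionField).comp
      (derivHom E)).toRingHom = RingHom.id E.toAffine.FunctionField :=
    IsLocalization.ringHom_ext E.toAffine.CoordinateRing⁰ <| RingHom.ext fun a =>
      (congrArg TrivSqZeroExt.fst (derivHom_algebraMap E a)).trans (fst_coordDerivHom E a)
  exact RingHom.congr_fun h f

theorem derivHom_inv (f : E.toAffine.FunctionField) : derivHom E f⁻¹ = (derivHom E f)⁻¹ :=
  map_inv_dualNumber (derivHom E).toRingHom f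

theorem derivHom_genX : derivHom E (genX E) = shiftX (genX E) (genY E) 1 := by
  have h := coordDerivHom_smul_basis E X 0
  rwa [zero_smul, add_zero, map_zero, zero_mul, add_zero, aeval_X, Affine.CoordinateRing.smul,
    mul_one, ← derivHom_algebraMap] at h

theorem derivHom_genY : derivHom E (genY E) = shiftY E (genX E) (genY E) 1 := by
  have h := coordDerivHom_smul_basis E 0 1
  rwa [zero_smul, one_smul, zero_add, map_zero, zero_add, map_one, one_mul,
    ← derivHom_algebraMap] at h

variable {E}

theorem dlog_derivHom_mul {f g : E.toAffine.FunctionField} (hf : f ≠ 0) (hg : g ≠ 0) :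
    dlog (derivHom E (f * g)) = dlog (derivHom E f) + dlog (derivHom E g) := by
  rw [map_mul, dlog_mul (by rwa [fst_derivHom]) (by rwa [fst_derivHom])]

theorem dlog_derivHom_algebraMap (k : K) :
    dlog (derivHom E (algebraMap K _ k)) = 0 := by
  rw [AlgHom.commutes, algebraMap_eq_inl']
  exact dlog_inl _

end Derivation

section Divisors

variable {A F : Type*} [CommRing A] [Field F] [Algebra A F] [IsFractionRing A F] {f g : F}
  {D D' : (FractionalIdeal A⁰ F)ˣ}

/-- The function `f` has divisor `D`, where divisors are written multiplicatively, as invertible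
fractional ideals. -/
def HasDivisor (f : F) (D : (FractionalIdeal A⁰ F)ˣ) : Prop :=
  FractionalIdeal.spanSingleton A⁰ f = D

theorem hasDivisor_one : HasDivisor (1 : F) (1 : (FractionalIdeal A⁰ F)ˣ) :=
  FractionalIdeal.spanSingleton_one

theorem HasDivisor.mul (hf : HasDivisor f D) (hg : HasDivisor g D') :
    HasDivisor (f * g) (D * D') := by
  rw [HasDivisor, Units.val_mul, ← hf, ← hg, FractionalIdeal.spanSingleton_mul_spanSingleton]

theorem HasDivisor.pow (hf : HasDivisor f D) (n : ℕ) : HasDivisor (f ^ n) (D ^ n) := by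
  rw [HasDivisor, Units.val_pow_eq_pow_val, ← hf, FractionalIdeal.spanSingleton_pow]

theorem HasDivisor.ne_zero (hf : HasDivisor f D) : f ≠ 0 := by
  rintro rfl
  have := (algebraMap A F).domain_nontrivial
  exact D.ne_zero (hf.symm.trans FractionalIdeal.spanSingleton_zero)

theorem HasDivisor.inv (hf : HasDivisor f D) : HasDivisor f⁻¹ D⁻¹ := by
  refine Units.eq_inv_of_mul_eq_one_right ?_
  rw [← hf, FractionalIdeal.spanSingleton_mul_spanSingleton, inv_mul_cancel₀ hf.ne_zero,
    FractionalIdeal.spanSingleton_one]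

theorem hasDivisor_algebraMap {a : A} {I : Ideal A} (hD : D = (I : FractionalIdeal A⁰ F)) :
    HasDivisor (algebraMap A F a) D ↔ Ideal.span {a} = I := by
  rw [HasDivisor, hD, ← FractionalIdeal.coeIdeal_span_singleton, FractionalIdeal.coeIdeal_inj]

theorem HasDivisor.exists_algebraMap_eq {I : Ideal A} (hf : HasDivisor f D)
    (hD : D = (I : FractionalIdeal A⁰ F)) : ∃ a, algebraMap A F a = f := by
  have hmem := FractionalIdeal.mem_spanSingleton_self A⁰ f
  rw [hf, hD] at hmem
  obtain ⟨a, -, ha⟩ := (FractionalIdeal.mem_coeIdeal A⁰).1 hmem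
  exact ⟨a, ha⟩

theorem HasDivisor.exists_eq_unit_smul [IsDomain A] (hf : HasDivisor f D) (hg : HasDivisor g D) :
    ∃ u : Aˣ, u • f = g :=
  FractionalIdeal.spanSingleton_eq_spanSingleton.1 (hf.trans hg.symm)

end Divisors

section PointIdeals

variable {K : Type*} [Field K] {E : WeierstrassCurve K}

/-- The prime divisor of a point of `E`: the ideal of functions on the affine curve that vanish
there, which is `1` for the point at infinity. -/
noncomputable def pointIdeal :
    E.toAffine.Point → (FractionalIdeal E.toAffine.CoordinateRing⁰ E.toAffine.FunctionField)ˣ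
  | .zero => 1
  | .some _ _ h => XYIdeal' (W := E.toAffine) h

theorem pointIdeal_zero : pointIdeal (0 : E.toAffine.Point) = 1 := rfl

theorem coe_pointIdeal_some {x y : K} (h : E.toAffine.Nonsingular x y) :
    (pointIdeal (.some x y h) : FractionalIdeal E.toAffine.CoordinateRing⁰ E.toAffine.FunctionField)
      = XYIdeal E.toAffine x (C y) := rfl

theorem genX_sub_algebraMap (x : K) :
    genX E - algebraMap K _ x = algebraMap E.toAffine.CoordinateRing _ (XClass E.toAffine x) := by
  rw [XClass, map_sub, map_sub, map_sub, genX]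
  rfl

theorem isAway_genX (P : E.toAffine.Point) : IsAway P (genX E) := by
  rcases P with _ | ⟨x, _, _⟩
  · exact isAway_zero
  · refine sub_ne_zero.1 ?_
    rw [genX_sub_algebraMap]
    exact IsFractionRing.to_map_ne_zero_of_mem_nonZeroDivisors
      (mem_nonZeroDivisors_of_ne_zero (XClass_ne_zero x))

variable [DecidableEq K]

theorem hasDivisor_lineVal_neg (P : E.toAffine.Point) :
    HasDivisor (lineVal P (-P) (genX E) (genY E)) (pointIdeal P * pointIdeal (-P)) := by
  rcases P with _ | ⟨x, y, h⟩
  · rw [← Affine.Point.zero_def, neg_zero, pointIdeal_zero, mul_one]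
    exact hasDivisor_one
  · rw [lineVal_neg_some, genX_sub_algebraMap]
    refine (hasDivisor_algebraMap (I := XIdeal E.toAffine x) ?_).2 rfl
    rw [Affine.Point.neg_some, Units.val_mul, coe_pointIdeal_some, coe_pointIdeal_some,
      ← FractionalIdeal.coeIdeal_mul, mul_comm, XYIdeal_neg_mul h]

theorem hasDivisor_lineVal_some {x₁ y₁ x₂ y₂ : K} (h₁ : E.toAffine.Nonsingular x₁ y₁)
    (h₂ : E.toAffine.Nonsingular x₂ y₂) (h : ¬ (x₁ = x₂ ∧ y₁ = E.toAffine.negY x₂ y₂)) :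
    HasDivisor (lineVal (.some x₁ y₁ h₁) (.some x₂ y₂ h₂) (genX E) (genY E))
      (pointIdeal (.some x₁ y₁ h₁) * pointIdeal (.some x₂ y₂ h₂) *
        pointIdeal (-(.some x₁ y₁ h₁ + .some x₂ y₂ h₂))) := by
  have hval : lineVal (.some x₁ y₁ h₁) (.some x₂ y₂ h₂) (genX E) (genY E) =
      algebraMap E.toAffine.CoordinateRing _
        (YClass E.toAffine (Affine.linePolynomial x₁ y₁ (E.toAffine.slope x₁ x₂ y₁ y₂))) := by
    rw [lineVal_some h, aeval_genX, genY, YClass, map_sub, map_sub]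
  have h₃ := Affine.nonsingular_add h₁ h₂ h
  rw [hval]
  refine (hasDivisor_algebraMap (I := YIdeal E.toAffine
    (Affine.linePolynomial x₁ y₁ (E.toAffine.slope x₁ x₂ y₁ y₂))) ?_).2 rfl
  rw [Affine.Point.add_some h, Affine.Point.neg_some,
    ← Units.mul_left_inj (pointIdeal (.some _ _ h₃))]
  simp only [Units.val_mul, coe_pointIdeal_some, ← FractionalIdeal.coeIdeal_mul]
  rw [mul_assoc, XYIdeal_neg_mul h₃, mul_comm _ (XIdeal _ _), XYIdeal_mul_XYIdeal h₁.1 h₂.1 h]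

theorem hasDivisor_lineVal (P Q : E.toAffine.Point) :
    HasDivisor (lineVal P Q (genX E) (genY E))
      (pointIdeal P * pointIdeal Q * pointIdeal (-(P + Q))) := by
  induction P, Q using pair_cases with
  | zero_left Q =>
    rw [lineVal_zero_left, pointIdeal_zero, one_mul, zero_add]
    exact hasDivisor_lineVal_neg Q
  | zero_right P =>
    rw [lineVal_zero_right, pointIdeal_zero, mul_one, add_zero]
    exact hasDivisor_lineVal_neg P
  | neg P =>
    rw [add_neg_cancel, neg_zero, pointIdeal_zero, mul_one]
    exact hasDivisor_lineVal_neg P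
  | secant h₁ h₂ h => exact hasDivisor_lineVal_some h₁ h₂ h

theorem hasDivisor_lineQuot (P Q : E.toAffine.Point) :
    HasDivisor (lineQuot P Q (genX E) (genY E))
      (pointIdeal P * pointIdeal Q * (pointIdeal (P + Q))⁻¹) := by
  have h := (hasDivisor_lineVal P Q).mul (hasDivisor_lineVal_neg (P + Q)).inv
  rwa [mul_inv_rev, mul_assoc, mul_inv_cancel_left] at h

theorem hasDivisor_millerVal_of_decomposes {S : Finset ℕ} {M : Multiset ℕ} {C : List (ℕ × ℕ)}
    (hC : Decomposes S M C) (P : E.toAffine.Point) :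
    HasDivisor (millerVal C P (genX E) (genY E))
      (pointIdeal P ^ M.sum * ((M.map fun n => pointIdeal (n • P)).prod)⁻¹) := by
  induction hC with
  | ones m => simpa [millerVal_nil] using hasDivisor_one
  | @step i j M C _ _ _ _ ih =>
    have h := (hasDivisor_lineQuot (i • P) (j • P)).mul ih
    rw [millerVal_cons]
    convert h using 1
    simp only [← div_eq_mul_inv, ← add_smul, Multiset.map_cons, Multiset.prod_cons,
      Multiset.sum_cons, ← add_assoc, ← mul_assoc]
    rw [div_mul_div_comm, mul_left_comm (pointIdeal ((i + j) • P)), mul_div_mul_left_eq_div]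

theorem hasDivisor_millerVal {p : ℕ} {S : Finset ℕ} {C : List (ℕ × ℕ)} (hC : Decomposes S {p} C)
    {P : E.toAffine.Point} (hP : p • P = 0) :
    HasDivisor (millerVal C P (genX E) (genY E)) (pointIdeal P ^ p) := by
  have h := hasDivisor_millerVal_of_decomposes hC P
  rwa [Multiset.sum_singleton, Multiset.map_singleton, Multiset.prod_singleton, hP, pointIdeal_zero,
    inv_one, mul_one] at h

theorem dlog_derivHom_millerVal [E.IsShortNF] {p : ℕ} [CharP K p] {S : Finset ℕ}
    {C : List (ℕ × ℕ)} (hC : Decomposes S {p} C) {P : E.toAffine.Point} (hP : p • P = 0) :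
    dlog (derivHom E (millerVal C P (genX E) (genY E))) = -algebraMap K _ (slopeSum C P) := by
  have : CharP E.toAffine.FunctionField p :=
    charP_of_injective_algebraMap (algebraMap K E.toAffine.FunctionField).injective p
  rw [map_millerVal (derivHom_inv E), derivHom_genX, derivHom_genY,
    dlog_millerVal (genY_sq E) (fun n => isAway_genX _) hP hC, neg_one_mul]

end PointIdeals

section Additivity

variable {K : Type*} [Field K] {E : WeierstrassCurve K}

theorem two_mul_natDegree_le_natDegree_norm (u v : K[X]) :
    2 * u.natDegree ≤ (Algebra.norm K[X] (u • 1 + v • mk E.toAffine X)).natDegree := by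
  rcases eq_or_ne u 0 with rfl | hu
  · simp
  · refine le_natDegree_of_coe_le_degree ?_
    rw [degree_norm_smul_basis, degree_eq_natDegree hu]
    exact (by norm_cast : ((2 * u.natDegree : ℕ) : WithBot ℕ) = 2 • u.natDegree).le.trans
      (le_max_left ..)

theorem two_mul_natDegree_add_three_le_natDegree_norm (u : K[X]) {v : K[X]} (hv : v ≠ 0) :
    2 * v.natDegree + 3 ≤ (Algebra.norm K[X] (u • 1 + v • mk E.toAffine X)).natDegree := by
  refine le_natDegree_of_coe_le_degree ?_
  rw [degree_norm_smul_basis, degree_eq_natDegree hv]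
  exact (by norm_cast : ((2 * v.natDegree + 3 : ℕ) : WithBot ℕ) = 2 • v.natDegree + 3).le.trans
    (le_max_right ..)

theorem smul_basis_eq_algebraMap {u : K[X]} (hu : u.natDegree = 0) :
    u • 1 + (0 : K[X]) • mk E.toAffine X = algebraMap K _ (u.coeff 0) := by
  rw [eq_C_of_natDegree_eq_zero hu, zero_smul, add_zero, Affine.CoordinateRing.smul, mul_one,
    coeff_C_zero]
  rfl

theorem exists_algebraMap_eq_of_isUnit {u : E.toAffine.CoordinateRing} (hu : IsUnit u) :
    ∃ c : K, u = algebraMap K _ c := by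
  obtain ⟨u, v, rfl⟩ := exists_smul_basis_eq u
  have hdeg := natDegree_eq_zero_of_isUnit (hu.map (Algebra.norm K[X]))
  obtain rfl : v = 0 := by
    by_contra hv
    have := two_mul_natDegree_add_three_le_natDegree_norm (E := E) u hv
    lia
  have := two_mul_natDegree_le_natDegree_norm (E := E) u 0
  exact ⟨_, smul_basis_eq_algebraMap (by lia)⟩

variable [E.IsShortNF] {f g : E.toAffine.FunctionField}
  {D : (FractionalIdeal E.toAffine.CoordinateRing⁰ E.toAffine.FunctionField)ˣ}

theorem dlog_derivHom_eq_of_hasDivisor (hf : HasDivisor f D) (hg : HasDivisor g D) :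
    dlog (derivHom E f) = dlog (derivHom E g) := by
  obtain ⟨z, rfl⟩ := hf.exists_eq_unit_smul hg
  obtain ⟨c, hc⟩ := exists_algebraMap_eq_of_isUnit z.isUnit
  have hz : algebraMap E.toAffine.CoordinateRing E.toAffine.FunctionField z =
      algebraMap K _ c := by rw [hc, ← IsScalarTower.algebraMap_apply]
  have hz₀ : algebraMap E.toAffine.CoordinateRing E.toAffine.FunctionField z ≠ 0 :=
    (z.isUnit.map _).ne_zero
  rw [Units.smul_def, Algebra.smul_def, dlog_derivHom_mul hz₀ hf.ne_zero, hz,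
    dlog_derivHom_algebraMap, zero_add]

theorem dlog_derivHom_pow_char {p : ℕ} [CharP K p] (hf : f ≠ 0) :
    dlog (derivHom E (f ^ p)) = 0 := by
  have : CharP E.toAffine.FunctionField p :=
    charP_of_injective_algebraMap (algebraMap K E.toAffine.FunctionField).injective p
  rw [map_pow, dlog_pow (by rwa [fst_derivHom]), CharP.cast_eq_zero, zero_mul]

variable [DecidableEq K] {p : ℕ} [CharP K p] {S : Finset ℕ} {C : List (ℕ × ℕ)}

theorem slopeSum_add (hC : Decomposes S {p} C) {P Q : E.toAffine.Point} (hP : p • P = 0)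
    (hQ : p • Q = 0) : slopeSum C (P + Q) = slopeSum C P + slopeSum C Q := by
  have hPQ : p • (P + Q) = 0 := by rw [smul_add, hP, hQ, add_zero]
  have dP := hasDivisor_millerVal hC hP
  have dQ := hasDivisor_millerVal hC hQ
  have dPQ := hasDivisor_millerVal hC hPQ
  have dline := hasDivisor_lineQuot P Q
  have hdiv : pointIdeal (P + Q) ^ p * (pointIdeal P * pointIdeal Q * (pointIdeal (P + Q))⁻¹) ^ p =
      pointIdeal P ^ p * pointIdeal Q ^ p := by
    rw [← mul_pow, ← mul_pow, mul_comm (pointIdeal (P + Q)), inv_mul_cancel_right]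
  have h := dlog_derivHom_eq_of_hasDivisor (hdiv ▸ dPQ.mul (dline.pow p)) (dP.mul dQ)
  rw [dlog_derivHom_mul dPQ.ne_zero (dline.pow p).ne_zero,
    dlog_derivHom_mul dP.ne_zero dQ.ne_zero, dlog_derivHom_pow_char dline.ne_zero, add_zero,
    dlog_derivHom_millerVal hC hP, dlog_derivHom_millerVal hC hQ, dlog_derivHom_millerVal hC hPQ,
    ← neg_add, neg_inj, ← map_add] at h
  exact (algebraMap K E.toAffine.FunctionField).injective h

/-- The sum of the slopes of the lines in Miller's algorithm, as a homomorphism `E[p] → K`: up to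
sign, it sends `P` to the invariant logarithmic derivative of the function with divisor `p(P - 𝒪)`,
which is a constant. -/
noncomputable def slopeHom (hC : Decomposes S {p} C) : BaseTorsion E p →+ K where
  toFun P := slopeSum C P.1
  map_zero' := slopeSum_zero C
  map_add' P Q := slopeSum_add hC (AddSubgroup.torsionBy.nsmul_iff.1 P.2)
    (AddSubgroup.torsionBy.nsmul_iff.1 Q.2)

end Additivity

section Constants

variable {K : Type*} [Field K]

theorem le_natDegree_of_derivative_eq_zero {p : ℕ} [CharP K p] {u : K[X]}
    (h : derivative u = 0) (hu : u.natDegree ≠ 0) : p ≤ u.natDegree := by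
  rcases eq_or_ne p 0 with rfl | hp
  · exact Nat.zero_le _
  rw [← expand_contract p h hp, natDegree_expand] at hu ⊢
  exact Nat.le_mul_of_pos_left p (Nat.pos_of_ne_zero (left_ne_zero_of_mul hu))

theorem pow_dvd_of_two_mul_derivative_mul_add_eq_zero {c v : K[X]} (hc : c.Separable)
    (h : 2 * derivative v * c + v * derivative c = 0) {n : ℕ}
    (hn : ∀ i < n, ((2 * i + 1 : ℕ) : K) ≠ 0) : c ^ n ∣ v := by
  induction n with
  | zero => exact one_dvd v
  | succ n ih =>
    obtain ⟨w, rfl⟩ := ih fun i hi => hn i (hi.trans n.lt_succ_self)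
    have hpow : derivative (c ^ n) * c = n * c ^ n * derivative c := by
      cases n with
      | zero => simp
      | succ n => rw [derivative_pow, map_natCast, Nat.add_sub_cancel, pow_succ]; ring
    have hw : c ^ n * (c * (2 * derivative w) + ((2 * n + 1 : ℕ) : K[X]) * w * derivative c) =
        0 := by
      rw [derivative_mul] at h
      push_cast
      linear_combination h - 2 * w * hpow
    have hw := (mul_eq_zero.1 hw).resolve_left (pow_ne_zero n hc.ne_zero)
    have hdvd : c ∣ ((2 * n + 1 : ℕ) : K[X]) * w * derivative c :=
      (dvd_add_right (dvd_mul_right c _)).1 (hw ▸ dvd_zero c)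
    have hunit : IsUnit ((2 * n + 1 : ℕ) : K[X]) := by
      rw [← map_natCast C, isUnit_C]
      exact isUnit_iff_ne_zero.2 (hn n n.lt_succ_self)
    rw [pow_succ]
    exact mul_dvd_mul_left _ (hunit.dvd_mul_left.1 (hc.dvd_of_dvd_mul_right hdvd))

variable {E : WeierstrassCurve K}

theorem natDegree_cubic : (cubic E).natDegree = 3 := by
  rw [cubic]
  compute_degree!

variable [E.IsShortNF]

theorem snd_coordDerivHom_smul_basis_eq_zero (h2 : (2 : K) ≠ 0) {u v : K[X]}
    (h : (coordDerivHom E (u • 1 + v • mk E.toAffine X)).snd = 0) :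
    derivative u = 0 ∧ 2 * derivative v * cubic E + v * derivative (cubic E) = 0 := by
  have h2 : (2 : K[X]) ≠ 0 := by rw [← map_ofNat C]; simpa using h2
  rw [snd_coordDerivHom_smul_basis] at h
  obtain ⟨hv, hu⟩ := smul_basis_eq_zero
    ((IsFractionRing.injective E.toAffine.CoordinateRing E.toAffine.FunctionField)
      (h.trans (map_zero _).symm))
  exact ⟨by simpa [h2] using hu, neg_eq_zero.1 hv⟩

variable [E.IsElliptic]

theorem separable_cubic : (cubic E).Separable := by
  have hΔ := E.isUnit_Δ.ne_zero
  rw [E.Δ_of_isShortNF] at hΔ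
  set d := 4 * E.a₄ ^ 3 + 27 * E.a₆ ^ 2 with hd
  have hc : C d⁻¹ * (4 * C E.a₄ ^ 3 + 27 * C E.a₆ ^ 2) = 1 := by
    rw [← C_1, ← inv_mul_cancel₀ (right_ne_zero_of_mul hΔ), C_mul, hd]
    simp only [map_add, map_mul, map_pow, map_ofNat]
  refine ⟨C d⁻¹ * -(18 * C E.a₄ * X - 27 * C E.a₆),
    C d⁻¹ * (6 * C E.a₄ * X ^ 2 - 9 * C E.a₆ * X + 4 * C E.a₄ ^ 2), ?_⟩
  rw [derivative_cubic, cubic]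
  linear_combination hc

theorem exists_algebraMap_eq_or_two_mul_le_natDegree_norm {p : ℕ} [Fact p.Prime] [CharP K p]
    {a : E.toAffine.CoordinateRing} (h : (coordDerivHom E a).snd = 0) :
    (∃ k : K, a = algebraMap K _ k) ∨ 2 * p ≤ (Algebra.norm K[X] a).natDegree := by
  obtain ⟨u, v, rfl⟩ := exists_smul_basis_eq a
  have h2 := DualPoint.two_ne_zero_of_isElliptic E
  obtain ⟨hu, hv⟩ := snd_coordDerivHom_smul_basis_eq_zero h2 h
  rcases eq_or_ne v 0 with rfl | hv₀
  · rcases eq_or_ne u.natDegree 0 with hu₀ | hu₀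
    · exact .inl ⟨_, smul_basis_eq_algebraMap hu₀⟩
    · have := le_natDegree_of_derivative_eq_zero (p := p) hu hu₀
      have := two_mul_natDegree_le_natDegree_norm (E := E) u 0
      exact .inr (by lia)
  · have hp2 : p ≠ 2 := by
      rintro rfl
      exact h2 (CharP.cast_eq_zero K 2)
    obtain ⟨m, hm⟩ := (Fact.out : p.Prime).odd_of_ne_two hp2
    have hdvd : cubic E ^ m ∣ v :=
      pow_dvd_of_two_mul_derivative_mul_add_eq_zero separable_cubic hv fun i hi hi₀ =>
        (Nat.le_of_dvd (by lia) ((CharP.cast_eq_zero_iff K p _).1 hi₀)).not_gt (by lia)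
    have hdeg := natDegree_le_of_dvd hdvd hv₀
    rw [natDegree_pow, natDegree_cubic] at hdeg
    have := two_mul_natDegree_add_three_le_natDegree_norm (E := E) u hv₀
    exact .inr (by lia)

end Constants

section Injectivity

variable {K : Type*} [Field K] {E : WeierstrassCurve K} {x y : K}

theorem XYIdeal_ne_top (h : E.toAffine.Nonsingular x y) : XYIdeal E.toAffine x (C y) ≠ ⊤ := by
  have := (quotientXYIdealEquiv h.1).toEquiv.nontrivial
  exact Ideal.Quotient.nontrivial_iff.1 this

theorem natDegree_norm_XClass (x : K) :
    (Algebra.norm K[X] (XClass E.toAffine x)).natDegree = 2 := by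
  have hx : XClass E.toAffine x = (X - C x) • 1 + (0 : K[X]) • mk E.toAffine X := by
    rw [XClass, zero_smul, add_zero, Affine.CoordinateRing.smul, mul_one]
  refine natDegree_eq_of_degree_eq_some ?_
  rw [hx, degree_norm_smul_basis, degree_X_sub_C, degree_zero]
  rfl

theorem natDegree_norm_add_natDegree_norm (h : E.toAffine.Nonsingular x y) {n : ℕ}
    {a b : E.toAffine.CoordinateRing} (ha : Ideal.span {a} = XYIdeal E.toAffine x (C y) ^ n)
    (hb : Ideal.span {b} = XYIdeal E.toAffine x (C (E.toAffine.negY x y)) ^ n) :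
    (Algebra.norm K[X] a).natDegree + (Algebra.norm K[X] b).natDegree = 2 * n := by
  have hmul : Ideal.span {a * b} = Ideal.span {XClass E.toAffine x ^ n} := by
    rw [← Ideal.span_singleton_mul_span_singleton, ha, hb, ← mul_pow, mul_comm,
      XYIdeal_neg_mul h, XIdeal, Ideal.span_singleton_pow]
  obtain ⟨z, hz⟩ := Ideal.span_singleton_eq_span_singleton.1 hmul
  have hX := natDegree_norm_XClass (E := E) x
  have hX₀ : Algebra.norm K[X] (XClass E.toAffine x) ≠ 0 :=
    ne_zero_of_natDegree_gt (n := 0) (by lia)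
  have hnorm := congrArg (Algebra.norm K[X]) hz
  have hne := hnorm.trans_ne (by rw [map_pow]; exact pow_ne_zero n hX₀)
  rw [map_mul, map_mul] at hnorm hne
  have hdeg := congrArg natDegree hnorm
  rw [natDegree_mul (left_ne_zero_of_mul hne) (right_ne_zero_of_mul hne),
    natDegree_mul (left_ne_zero_of_mul (left_ne_zero_of_mul hne))
      (right_ne_zero_of_mul (left_ne_zero_of_mul hne)),
    natDegree_eq_zero_of_isUnit (z.isUnit.map _), add_zero, map_pow, natDegree_pow, hX] at hdeg
  rw [hdeg, mul_comm]

variable [DecidableEq K] [E.IsShortNF] [E.IsElliptic] {p : ℕ} [Fact p.Prime] [CharP K p]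
  {S : Finset ℕ} {C : List (ℕ × ℕ)}

theorem exists_span_eq_pow_of_slopeSum_eq_zero (hC : Decomposes S {p} C)
    (h : E.toAffine.Nonsingular x y) (hP : p • (.some x y h : E.toAffine.Point) = 0)
    (h₀ : slopeSum C (.some x y h : E.toAffine.Point) = 0) :
    ∃ a : E.toAffine.CoordinateRing,
      Ideal.span {a} = XYIdeal E.toAffine x (Polynomial.C y) ^ p ∧
        2 * p ≤ (Algebra.norm K[X] a).natDegree := by
  have hdiv := hasDivisor_millerVal hC hP
  have hI : ((pointIdeal (.some x y h) ^ p : (FractionalIdeal _ _)ˣ) :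
      FractionalIdeal E.toAffine.CoordinateRing⁰ E.toAffine.FunctionField) =
        (XYIdeal E.toAffine x (Polynomial.C y) ^ p : Ideal _) := by
    rw [Units.val_pow_eq_pow_val, coe_pointIdeal_some, FractionalIdeal.coeIdeal_pow]
  obtain ⟨a, ha⟩ := hdiv.exists_algebraMap_eq hI
  have hspan := (hasDivisor_algebraMap hI).1 (ha ▸ hdiv)
  have ha₀ := ha.trans_ne hdiv.ne_zero
  have hsnd : (coordDerivHom E a).snd = 0 := by
    have hdlog := dlog_derivHom_millerVal hC hP
    rwa [h₀, map_zero, neg_zero, ← ha, derivHom_algebraMap, dlog, fst_coordDerivHom,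
      div_eq_zero_iff, or_iff_left ha₀] at hdlog
  refine ⟨a, hspan, (exists_algebraMap_eq_or_two_mul_le_natDegree_norm hsnd).resolve_left ?_⟩
  rintro ⟨k, rfl⟩
  have hk : k ≠ 0 := by
    rintro rfl
    simp at ha₀
  refine XYIdeal_ne_top h (Ideal.eq_top_of_isUnit_mem _ (Ideal.pow_le_self
    (Fact.out : p.Prime).ne_zero (hspan ▸ Ideal.mem_span_singleton_self _)) ?_)
  exact (isUnit_iff_ne_zero.2 hk).map _

theorem slopeHom_injective (hC : Decomposes S {p} C) :
    Function.Injective (slopeHom (E := E) hC) := by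
  rw [injective_iff_map_eq_zero]
  rintro ⟨_ | ⟨x, y, h⟩, hP⟩ h₀
  · rfl
  have hneg : slopeHom hC (-⟨.some x y h, hP⟩) = 0 := by rw [map_neg, h₀, neg_zero]
  obtain ⟨a, ha, hdega⟩ := exists_span_eq_pow_of_slopeSum_eq_zero hC h
    (AddSubgroup.torsionBy.nsmul_iff.1 hP) h₀
  obtain ⟨b, hb, hdegb⟩ := exists_span_eq_pow_of_slopeSum_eq_zero hC
    ((E.toAffine.nonsingular_neg x y).2 h)
    (AddSubgroup.torsionBy.nsmul_iff.1 (neg_mem hP)) hneg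
  have := natDegree_norm_add_natDegree_norm h ha hb
  have := (Fact.out : p.Prime).pos
  lia

end Injectivity

section RootsOfUnity

variable {K : Type*} [Field K] {p : ℕ}

theorem rootsOfUnity_ext {z w : rootsOfUnity p K[ε]}
    (h : ((z : K[ε]ˣ) : K[ε]) = ((w : K[ε]ˣ) : K[ε])) : z = w :=
  Subtype.ext (Units.ext h)

variable (p) [NeZero p] [CharP K p]

/-- The `p`-th root of unity `1 + aε` in `K[ε]`, for `K` of characteristic `p`. -/
noncomputable def oneAddEps (a : K) : rootsOfUnity p K[ε] :=
  rootsOfUnity.mkOfPowEq (1 + inr a) (by ext <;> simp)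

theorem coe_oneAddEps (a : K) : ((oneAddEps p a : K[ε]ˣ) : K[ε]) = 1 + inr a := rfl

theorem oneAddEps_add (a b : K) : oneAddEps p (a + b) = oneAddEps p a * oneAddEps p b :=
  rootsOfUnity_ext (by ext <;> simp [coe_oneAddEps, add_comm])

theorem oneAddEps_eq_one_iff {a : K} : oneAddEps p a = 1 ↔ a = 0 := by
  refine ⟨fun h => ?_, fun h => rootsOfUnity_ext (by simp [coe_oneAddEps, h])⟩
  simpa [coe_oneAddEps] using
    congrArg (fun z : rootsOfUnity p K[ε] => ((z : K[ε]ˣ) : K[ε]).snd) h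

end RootsOfUnity

section Decomposition

variable {K : Type*} [Field K] [DecidableEq K] {E : WeierstrassCurve K} [E.IsShortNF]

theorem DualPoint.translate_eq_zero_iff {P : E.toAffine.Point} {k : K} :
    DualPoint.translate P k = 0 ↔ P = 0 ∧ k = 0 := by
  refine ⟨fun h => ?_, fun ⟨hP, hk⟩ => by rw [hP, hk]; exact DualPoint.translate_zero 0⟩
  rcases P with _ | ⟨x, y, hxy⟩
  · exact ⟨rfl, DualPoint.inf.inj ((DualPoint.translate_zero k).symm.trans h)⟩
  · cases (h : DualPoint.affine _ _ _ = (DualPoint.inf 0 : DualPoint E))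

variable [E.IsElliptic]

theorem DualPoint.nsmul_translate (n : ℕ) (P : E.toAffine.Point) (k : K) :
    n • DualPoint.translate P k = DualPoint.translate (n • P) (n • k) :=
  (map_nsmul (DualPoint.ofBaseHom.coprod DualPoint.infHom) n (P, k)).symm

variable {p : ℕ} [CharP K p]

variable (E p) in
/-- The addition map `E[p] × K → Ẽ[p]`, `(P, k) ↦ P + 𝒪ₖ`. -/
noncomputable def torsionHom : BaseTorsion E p × K →+ DualTorsion E p where
  toFun P := baseTorsion P.1 + thetaTorsion E p P.2
  map_zero' := Subtype.ext (DualPoint.translate_zero 0)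
  map_add' P Q := Subtype.ext (DualPoint.translate_add_translate P.1.1 Q.1.1 P.2 Q.2).symm

theorem torsionHom_bijective : Function.Bijective (torsionHom E p) := by
  refine ⟨(injective_iff_map_eq_zero _).2 fun ⟨P, k⟩ h => ?_, fun P => ?_⟩
  · obtain ⟨hP, rfl⟩ := DualPoint.translate_eq_zero_iff.1 (congrArg Subtype.val h)
    exact Prod.ext (Subtype.ext hP) rfl
  · obtain ⟨Q, k, hQ⟩ := DualPoint.translate_surjective P.1
    have hp : p • P.1 = 0 := AddSubgroup.torsionBy.nsmul_iff.1 P.2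
    rw [hQ, DualPoint.nsmul_translate, DualPoint.translate_eq_zero_iff] at hp
    exact ⟨(⟨Q, AddSubgroup.torsionBy.nsmul_iff.2 hp.1⟩, k), Subtype.ext hQ.symm⟩

variable (E p) in
/-- The decomposition `Ẽ[p] = E[p] ⊕ Θ`. -/
noncomputable def torsionEquiv : BaseTorsion E p × K ≃+ DualTorsion E p :=
  AddEquiv.ofBijective (torsionHom E p) torsionHom_bijective

theorem torsionEquiv_apply (P : BaseTorsion E p × K) :
    torsionEquiv E p P = baseTorsion P.1 + thetaTorsion E p P.2 := rfl

theorem torsionEquiv_symm_baseTorsion (P : BaseTorsion E p) :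
    (torsionEquiv E p).symm (baseTorsion P) = (P, 0) :=
  (torsionEquiv E p).symm_apply_eq.2 (add_zero _).symm

theorem torsionEquiv_symm_thetaTorsion (k : K) :
    (torsionEquiv E p).symm (thetaTorsion E p k) = (0, k) :=
  (torsionEquiv E p).symm_apply_eq.2 (zero_add _).symm

theorem IsWeilExtension.eq {e : BaseTorsion E p → K → K[ε]}
    {ep ep' : DualTorsion E p → DualTorsion E p → rootsOfUnity p K[ε]}
    (h : IsWeilExtension e ep) (h' : IsWeilExtension e ep') : ep = ep' := by
  funext P Q
  have hmixed (P k) : ep (baseTorsion P) (thetaTorsion E p k) =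
      ep' (baseTorsion P) (thetaTorsion E p k) :=
    rootsOfUnity_ext ((h.extends_e P k).trans (h'.extends_e P k).symm)
  obtain ⟨P, rfl⟩ := (torsionEquiv E p).surjective P
  obtain ⟨Q, rfl⟩ := (torsionEquiv E p).surjective Q
  simp only [torsionEquiv_apply, h.add_left, h.add_right, h'.add_left, h'.add_right, h.base_base,
    h'.base_base, h.theta_theta, h'.theta_theta, hmixed]
  rw [h.antisymm (thetaTorsion E p _), h'.antisymm (thetaTorsion E p _), hmixed]

variable [NeZero p]

/-- The pairing on `Ẽ[p]` that sends `(P + 𝒪ⱼ, Q + 𝒪ₖ)` to `1 + (k c(P) - j c(Q))ε`. -/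
noncomputable def dualPairing (c : BaseTorsion E p →+ K) (P Q : DualTorsion E p) :
    rootsOfUnity p K[ε] :=
  oneAddEps p (((torsionEquiv E p).symm Q).2 * c ((torsionEquiv E p).symm P).1 -
    ((torsionEquiv E p).symm P).2 * c ((torsionEquiv E p).symm Q).1)

variable {c : BaseTorsion E p →+ K}

theorem isWeilExtension_dualPairing {e : BaseTorsion E p → K → K[ε]}
    (he : ∀ P k, e P k = 1 + inr (k * c P)) : IsWeilExtension e (dualPairing c) where
  extends_e P k := by
    simp [dualPairing, torsionEquiv_symm_baseTorsion, torsionEquiv_symm_thetaTorsion, he,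
      coe_oneAddEps]
  base_base P Q := by simp [dualPairing, torsionEquiv_symm_baseTorsion, oneAddEps_eq_one_iff]
  theta_theta j k := by simp [dualPairing, torsionEquiv_symm_thetaTorsion, oneAddEps_eq_one_iff]
  add_left P P' Q := by
    rw [dualPairing, dualPairing, dualPairing, ← oneAddEps_add, map_add, Prod.fst_add,
      Prod.snd_add, map_add]
    ring_nf
  add_right P Q Q' := by
    rw [dualPairing, dualPairing, dualPairing, ← oneAddEps_add, map_add, Prod.fst_add,
      Prod.snd_add, map_add]
    ring_nf
  antisymm P Q := by
    rw [eq_inv_iff_mul_eq_one, dualPairing, dualPairing, ← oneAddEps_add, oneAddEps_eq_one_iff]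
    ring

theorem eq_zero_of_forall_dualPairing_eq_one [Nontrivial (BaseTorsion E p)]
    (hc : Function.Injective c) {Q : DualTorsion E p} (hQ : ∀ P, dualPairing c P Q = 1) :
    Q = 0 := by
  obtain ⟨R, hR⟩ := exists_ne (0 : BaseTorsion E p)
  have hbase := hQ (baseTorsion R)
  have htheta := hQ (thetaTorsion E p 1)
  rw [dualPairing, oneAddEps_eq_one_iff, torsionEquiv_symm_baseTorsion, zero_mul, sub_zero,
    mul_eq_zero_iff_right ((map_ne_zero_iff c hc).2 hR)] at hbase
  rw [dualPairing, oneAddEps_eq_one_iff, torsionEquiv_symm_thetaTorsion, map_zero, mul_zero,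
    zero_sub, one_mul, neg_eq_zero, map_eq_zero_iff c hc] at htheta
  exact (map_eq_zero_iff _ (torsionEquiv E p).symm.injective).1 (Prod.ext htheta hbase)

end Decomposition

end DualCurve

theorem theorem2_general {K : Type*} [Field K] [DecidableEq K] (p : ℕ) [Fact p.Prime] [CharP K p]
    (E : WeierstrassCurve K) [E.IsShortNF] [E.IsElliptic]
    (R : E.toAffine.Point) (hR : p • R = 0) (hR0 : R ≠ 0)
    (T : E.toAffine.Point) (hT : p • T ≠ 0)
    {S : Finset ℕ} (C : List (ℕ × ℕ)) (hC : DualCurve.Decomposes S {p} C) :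
    (∀ P : DualCurve.DualTorsion E p, ∃! Q : DualCurve.BaseTorsion E p × K,
      P = DualCurve.baseTorsion Q.1 + DualCurve.thetaTorsion E p Q.2) ∧
    ∃ ep : DualCurve.DualTorsion E p → DualCurve.DualTorsion E p → rootsOfUnity p K[ε],
      DualCurve.IsWeilExtension (DualCurve.millerPairing C R T) ep ∧
      (∀ ep', DualCurve.IsWeilExtension (DualCurve.millerPairing C R T) ep' → ep' = ep) ∧
      (∀ Q, (∀ P, ep P Q = 1) → Q = 0) ∧
      (∀ P, (∀ Q, ep P Q = 1) → P = 0) := by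
  have hpair (P : DualCurve.BaseTorsion E p) (k : K) : DualCurve.millerPairing C R T P k =
      1 + TrivSqZeroExt.inr (k * (-DualCurve.slopeHom hC) P) := by
    rw [DualCurve.millerPairing_eq hR hT hC, ← mul_neg]
    rfl
  have hW := DualCurve.isWeilExtension_dualPairing hpair
  have hinj : Function.Injective (-DualCurve.slopeHom (E := E) hC) :=
    neg_injective.comp (DualCurve.slopeHom_injective hC)
  have : Nontrivial (DualCurve.BaseTorsion E p) :=
    ⟨⟨R, AddSubgroup.torsionBy.nsmul_iff.2 hR⟩, 0, fun h => hR0 (congrArg Subtype.val h)⟩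
  refine ⟨fun P => ?_, _, hW, fun _ h => h.eq hW, fun Q hQ => ?_, fun P hP => ?_⟩
  · obtain ⟨Q, hQ, huniq⟩ := DualCurve.torsionHom_bijective.existsUnique P
    exact ⟨Q, hQ.symm, fun Q' h => huniq Q' h.symm⟩
  · exact DualCurve.eq_zero_of_forall_dualPairing_eq_one hinj hQ
  · exact DualCurve.eq_zero_of_forall_dualPairing_eq_one hinj fun Q => by
      rw [hW.antisymm, hP, inv_one]

theorem theorem2 {K : Type*} [Field K] [IsAlgClosed K] [DecidableEq K] (p : ℕ) [Fact p.Prime]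
    [CharP K p] (hp2 : p ≠ 2) (hp3 : p ≠ 3)
    (E : WeierstrassCurve K) [E.IsShortNF] [E.IsElliptic]
    (R : E.toAffine.Point) (hR : p • R = 0) (hR2 : 2 • R ≠ 0)
    (T : E.toAffine.Point) (hT : T ≠ 0) (hT2 : 2 • T = 0)
    (C : List (ℕ × ℕ)) (hC : DualCurve.IsAdditionChainDecomposition p C) :
    (∀ P : DualCurve.DualTorsion E p, ∃! Q : DualCurve.BaseTorsion E p × K,
      P = DualCurve.baseTorsion Q.1 + DualCurve.thetaTorsion E p Q.2) ∧
    ∃ ep : DualCurve.DualTorsion E p → DualCurve.DualTorsion E p → rootsOfUnity p K[ε],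
      DualCurve.IsWeilExtension (DualCurve.millerPairing C R T) ep ∧
      (∀ ep', DualCurve.IsWeilExtension (DualCurve.millerPairing C R T) ep' → ep' = ep) ∧
      (∀ Q, (∀ P, ep P Q = 1) → Q = 0) ∧
      (∀ P, (∀ Q, ep P Q = 1) → P = 0) := by
  have hpT : p • T = T :=
    DualCurve.nsmul_eq_self_of_odd hT2 ((Fact.out : p.Prime).odd_of_ne_two hp2)
  exact theorem2_general p E R hR (by rintro rfl; exact hR2 (smul_zero 2)) T (by rwa [hpT]) C
    hC.choose_spec.2
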